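/- Let $n\ge 0$ and $N=2^n$. For $\theta\in\mathbb R^n$ let $B(\theta)\in\mathbb R^{N\times N}$ be the simple scalar butterfly matrix, defined recursively by $B()=(1)$ and $$B(\theta_1,\dots,\theta_{n})=\begin{bmatrix}\cos\theta_n\,A&\sin\theta_n\,A\\-\sin\theta_n\,A&\cos\theta_n\,A\end{bmatrix},\qquad A=B(\theta_1,\dots,\theta_{n-1}).$$ Let $B$ be a Haar-butterfly matrix, i.e. a random matrix distributed as $B(\theta_1,\dots,\theta_n)$ with $\theta_1,\dots,\theta_n$ independent and uniform on $[0,2\pi)$. Let $\|A\|_{\max}=\max_{i,j}|A_{ij}|$, let $\|A\|_\infty$ be the matrix norm induced by the $\ell_\infty$ vector norm, and let $\kappa_\infty(A)=\|A\|_\infty\|A^{-1}\|_\infty$. For Gaussian elimination with a pivoting strategy, let $PAQ=LU$ be the resulting factorization ($P,Q$ permutation matrices, $L$ unit lower triangular, $U$ upper triangular), let $A^{(k)}$ be the matrix before the $k$-th elimination step ($1\le k\le N$, so $A^{(1)}=A$, $A^{(N)}=U$), and set $$\rho(A)=\frac{\|L\|_{\max}\max_k\|A^{(k)}\|_{\max}}{\|A\|_{\max}},\qquad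 \rho_o(A)=\frac{\|\,|L||U|\,\|_\infty}{\|A\|_\infty},\qquad \rho_\infty(A)=\frac{\|L\|_\infty\|U\|_\infty}{\|A\|_\infty},$$ where $|\cdot|$ of a matrix is taken entrywise. In partial pivoting (GEPP) the pivot of step $k$ is an entry of largest modulus in rows $k,\dots,N$ of column $k$. In rook pivoting (GERP) the pivot of step $k$ is found in the submatrix with rows and columns $k,\dots,N$ by starting at an entry of largest modulus in its first column and then moving alternately to an entry of largest modulus in the current row and in the current column, as long as the modulus strictly increases, until the entry is of largest modulus in both its row and its column. In both strategies ties may be broken by any fixed rule. Then $\kappa_\infty(B)$ is integrable and $$\mathbb E\,\kappa_\infty(B)=N^{\xi},\qquad \xi=\log_2\!\left(1+\tfrac2\pi\right).$$ Moreover, using GEPP or GERP, the following products are integrable and $$\mathbb E\,\kappa_\infty(B)\rho(B)=N^{1+\zeta},\qquad \mathbb E\,\kappa_\infty(B)\rho_o(B)=N^{1+\psi},\qquad \mathbb E\,\kappa_\infty(B)\rho_\infty(B)=N^{1+\phi},$$ where, with $\log$ the natural logarithm, $$\zeta=\log_2\!\left(\tfrac2\pi(1+\log 2)\right),\qquad \psi=\log_2\!\left(1+\tfrac{\log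 4-1}\pi\right),\qquad \phi=\log_2\!\left(1+\tfrac{\log 2}\pi\right).$$ -/

import Mathlib

open MeasureTheory ProbabilityTheory

/-- The product (Borel) sigma-algebra on real matrices. -/
instance instMeasurableSpaceRealMatrix {m n : Type*} : MeasurableSpace (Matrix m n ℝ) :=
  MeasurableSpace.pi

namespace ButterflyGE

/-! ### Matrix norms, condition number -/

section Norms

open scoped Matrix.Norms.Elementwise in
/-- The elementwise max norm `max_{i,j} |A i j|`. -/
noncomputable def maxNorm {N : ℕ} (A : Matrix (Fin N) (Fin N) ℝ) : ℝ := ‖A‖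

open scoped Matrix.Norms.Operator in
/-- The matrix norm induced by the `ℓ_∞` vector norm. -/
noncomputable def inftyNorm {N : ℕ} (A : Matrix (Fin N) (Fin N) ℝ) : ℝ := ‖A‖

/-- The `ℓ_∞`-condition number. -/
noncomputable def kappaInf {N : ℕ} (A : Matrix (Fin N) (Fin N) ℝ) : ℝ :=
  inftyNorm A * inftyNorm A⁻¹

/-- The matrix `|A|` of entrywise absolute values. -/
def absMatrix {N : ℕ} (A : Matrix (Fin N) (Fin N) ℝ) : Matrix (Fin N) (Fin N) ℝ :=
  A.map fun x => |x|

end Norms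

/-! ### Simple scalar butterfly matrices and the Haar-butterfly ensemble -/

/-- The simple scalar butterfly matrix `B(θ)` of size `2 ^ n`: with `A` the butterfly matrix built
from all angles but the last and `t` the last angle,
`B(θ) = [[cos t * A, sin t * A], [-sin t * A, cos t * A]]`; for `n = 0` it is the matrix `(1)`. -/
noncomputable def butterfly : (n : ℕ) → (Fin n → ℝ) → Matrix (Fin (2 ^ n)) (Fin (2 ^ n)) ℝ
  | 0, _ => 1
  | n + 1, θ =>
    let A := butterfly n fun i => θ i.castSucc
    let t := θ (Fin.last n)
    let e : Fin (2 ^ n) ⊕ Fin (2 ^ n) ≃ Fin (2 ^ (n + 1)) :=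
      finSumFinEquiv.trans (finCongr (by rw [pow_succ, mul_two]))
    Matrix.reindex e e
      (Matrix.fromBlocks (Real.cos t • A) (Real.sin t • A) (-(Real.sin t • A)) (Real.cos t • A))

/-- The uniform probability distribution on `[0, 2π)`. -/
noncomputable def uniformAngle : Measure ℝ :=
  ProbabilityTheory.cond volume (Set.Ico 0 (2 * Real.pi))

/-- The law of a Haar-butterfly matrix of size `2 ^ n`: the law of `B(θ₁, …, θₙ)` where the angles
are independent and uniform on `[0, 2π)`. -/
noncomputable def haarButterfly (n : ℕ) : Measure (Matrix (Fin (2 ^ n)) (Fin (2 ^ n)) ℝ) :=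
  (Measure.pi fun _ : Fin n => uniformAngle).map (butterfly n)

instance : IsProbabilityMeasure uniformAngle := by
  apply ProbabilityTheory.cond_isProbabilityMeasure_of_finite
  · simp [Real.volume_Ico, Real.pi_pos]
  · rw [Real.volume_Ico]
    exact ENNReal.ofReal_ne_top

theorem measurable_butterfly (n : ℕ) : Measurable (butterfly n) := by
  induction n with
  | zero => exact measurable_const
  | succ n ih =>
    have hA : Measurable fun θ : Fin (n + 1) → ℝ => butterfly n fun i => θ i.castSucc :=
      ih.comp (measurable_pi_lambda _ fun i => measurable_pi_apply _)
    have hE : ∀ i j, Measurable fun θ : Fin (n + 1) → ℝ =>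
        butterfly n (fun i => θ i.castSucc) i j := fun i j =>
      (measurable_pi_apply j).comp ((measurable_pi_apply i).comp hA)
    refine measurable_pi_lambda _ fun i => measurable_pi_lambda _ fun j => ?_
    simp only [butterfly, Matrix.reindex_apply, Matrix.submatrix_apply]
    rcases Equiv.symm _ i with a | a <;> rcases Equiv.symm _ j with b | b <;>
      simp only [Matrix.fromBlocks_apply₁₁, Matrix.fromBlocks_apply₁₂, Matrix.fromBlocks_apply₂₁,
        Matrix.fromBlocks_apply₂₂, Matrix.neg_apply, Matrix.smul_apply, smul_eq_mul] <;>
      have := hE a b <;> fun_prop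

instance (n : ℕ) : IsProbabilityMeasure (haarButterfly n) :=
  Measure.isProbabilityMeasure_map (measurable_butterfly n).aemeasurable

/-! ### Gaussian elimination with pivoting -/

/-- A pivot rule: from the current matrix and the index `k` of the elimination step, it returns the
position `(row, column)` of the entry used as the pivot of this step. -/
abbrev PivotRule (N : ℕ) := Matrix (Fin N) (Fin N) ℝ → Fin N → Fin N × Fin N

/-- Entry `(r, c)` is of maximal modulus among the rows `i ≥ k` of column `c`. -/
def IsColMax {N : ℕ} (A : Matrix (Fin N) (Fin N) ℝ) (k r c : Fin N) : Prop :=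
  k ≤ r ∧ ∀ i, k ≤ i → |A i c| ≤ |A r c|

/-- Entry `(r, c)` is of maximal modulus among the columns `j ≥ k` of row `r`. -/
def IsRowMax {N : ℕ} (A : Matrix (Fin N) (Fin N) ℝ) (k r c : Fin N) : Prop :=
  k ≤ c ∧ ∀ j, k ≤ j → |A r j| ≤ |A r c|

/-- Partial pivoting (GEPP): at step `k` the pivot is an entry of maximal modulus in the part of
column `k` that is not yet eliminated; ties may be broken in any way. -/
def IsPartialPivoting {N : ℕ} (piv : PivotRule N) : Prop :=
  ∀ A k, (piv A k).2 = k ∧ IsColMax A k (piv A k).1 k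

/-- The positions visited by the rook search at step `k`: it starts at an entry of maximal modulus in
column `k`, then moves alternately along rows and columns of the remaining submatrix, each time to
an entry of maximal modulus in that row or column, as long as this modulus strictly increases. -/
inductive RookSearch {N : ℕ} (A : Matrix (Fin N) (Fin N) ℝ) (k : Fin N) : Fin N → Fin N → Prop
  | start (r : Fin N) : IsColMax A k r k → RookSearch A k r k
  | row (r c c' : Fin N) : RookSearch A k r c → IsRowMax A k r c' → |A r c| < |A r c'| →
      RookSearch A k r c'
  | col (r r' c : Fin N) : RookSearch A k r c → IsColMax A k r' c → |A r c| < |A r' c| →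
      RookSearch A k r' c

/-- Rook pivoting (GERP): the pivot is an entry at which the rook search stops, that is, an entry
of maximal modulus both in its row and in its column; ties may be broken in any way. -/
def IsRookPivoting {N : ℕ} (piv : PivotRule N) : Prop :=
  ∀ A k, RookSearch A k (piv A k).1 (piv A k).2 ∧
    IsColMax A k (piv A k).1 (piv A k).2 ∧ IsRowMax A k (piv A k).1 (piv A k).2

theorem exists_isColMax {N : ℕ} (A : Matrix (Fin N) (Fin N) ℝ) (k c : Fin N) :
    ∃ r, IsColMax A k r c := by
  obtain ⟨r, hr, h⟩ := Finset.exists_max_image (Finset.Ici k) (fun i => |A i c|) ⟨k, by simp⟩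
  exact ⟨r, by simpa using hr, fun i hi => h i (by simpa using hi)⟩

theorem exists_isRowMax {N : ℕ} (A : Matrix (Fin N) (Fin N) ℝ) (k r : Fin N) :
    ∃ c, IsRowMax A k r c :=
  exists_isColMax A.transpose k r

theorem exists_isPartialPivoting (N : ℕ) : ∃ piv : PivotRule N, IsPartialPivoting piv := by
  choose r hr using fun (A : Matrix (Fin N) (Fin N) ℝ) k => exists_isColMax A k k
  exact ⟨fun A k => (r A k, k), fun A k => ⟨rfl, hr A k⟩⟩

theorem RookSearch.le {N : ℕ} {A : Matrix (Fin N) (Fin N) ℝ} {k r c : Fin N}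
    (h : RookSearch A k r c) : k ≤ r ∧ k ≤ c := by
  induction h with
  | start r h => exact ⟨h.1, le_rfl⟩
  | row r c c' _ h _ ih => exact ⟨ih.1, h.1⟩
  | col r r' c _ h _ ih => exact ⟨h.1, ih.2⟩

theorem exists_isRookPivoting (N : ℕ) : ∃ piv : PivotRule N, IsRookPivoting piv := by
  have key : ∀ (A : Matrix (Fin N) (Fin N) ℝ) (k : Fin N), ∃ p : Fin N × Fin N,
      RookSearch A k p.1 p.2 ∧ IsColMax A k p.1 p.2 ∧ IsRowMax A k p.1 p.2 := by
    intro A k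
    obtain ⟨r₀, h₀⟩ := exists_isColMax A k k
    obtain ⟨⟨r, c⟩, hp, hmax⟩ := Set.exists_max_image {p : Fin N × Fin N | RookSearch A k p.1 p.2}
      (fun p => |A p.1 p.2|) (Set.toFinite _) ⟨(r₀, k), RookSearch.start r₀ h₀⟩
    refine ⟨(r, c), hp, ⟨hp.le.1, fun i hi => ?_⟩, ⟨hp.le.2, fun j hj => ?_⟩⟩
    · obtain ⟨r', h'⟩ := exists_isColMax A k c
      by_contra! hlt
      have hs := hlt.trans_le (h'.2 i hi)
      exact absurd (hmax (r', c) (RookSearch.col r r' c hp h' hs)) (not_le.mpr hs)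
    · obtain ⟨c', h'⟩ := exists_isRowMax A k r
      by_contra! hlt
      have hs := hlt.trans_le (h'.2 j hj)
      exact absurd (hmax (r, c') (RookSearch.row r c c' hp h' hs)) (not_le.mpr hs)
  choose p hp using key
  exact ⟨p, hp⟩

/-- State of an elimination: `U` is the current matrix and `M` holds the multipliers used so far
(in the strictly lower triangle, rows interchanged along with those of `U`). -/
structure GEState (N : ℕ) where
  U : Matrix (Fin N) (Fin N) ℝ
  M : Matrix (Fin N) (Fin N) ℝ

/-- Step `k` of the elimination: bring the pivot to position `(k, k)` by interchanging two rows and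
two columns, then subtract multiples of row `k` from the rows below it, so as to annihilate
the entries of column `k` below the diagonal. -/
noncomputable def geStep {N : ℕ} (piv : PivotRule N) (k : Fin N) (s : GEState N) : GEState N :=
  let V := s.U.submatrix (Equiv.swap k (piv s.U k).1) (Equiv.swap k (piv s.U k).2)
  let m : Fin N → ℝ := fun i => if k < i then V i k / V k k else 0
  { U := fun i j => V i j - m i * V k j
    M := fun i j => if j = k then m i else s.M (Equiv.swap k (piv s.U k).1 i) j }

/-- The state after the first `j` steps applied to `A`. -/
noncomputable def geState {N : ℕ} (piv : PivotRule N) (A : Matrix (Fin N) (Fin N) ℝ) :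
    ℕ → GEState N
  | 0 => ⟨A, 0⟩
  | j + 1 => if h : j < N then geStep piv ⟨j, h⟩ (geState piv A j) else geState piv A j

/-- The unit lower triangular factor `L` in `P A Q = L U`. -/
noncomputable def geL {N : ℕ} (piv : PivotRule N) (A : Matrix (Fin N) (Fin N) ℝ) :
    Matrix (Fin N) (Fin N) ℝ :=
  1 + (geState piv A N).M

/-- The upper triangular factor `U` in `P A Q = L U`. -/
noncomputable def geU {N : ℕ} (piv : PivotRule N) (A : Matrix (Fin N) (Fin N) ℝ) :
    Matrix (Fin N) (Fin N) ℝ :=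
  (geState piv A N).U

/-! ### Growth factors -/

/-- The max-norm growth factor `ρ(A) = ‖L‖_max * max_k ‖A^(k)‖_max / ‖A‖_max`. -/
noncomputable def rho {N : ℕ} (piv : PivotRule N) (A : Matrix (Fin N) (Fin N) ℝ) : ℝ :=
  maxNorm (geL piv A) * (⨆ k : Fin N, maxNorm (geState piv A k).U) / maxNorm A

/-- The growth factor `ρ_o(A) = ‖|L| |U|‖_∞ / ‖A‖_∞`. -/
noncomputable def rhoO {N : ℕ} (piv : PivotRule N) (A : Matrix (Fin N) (Fin N) ℝ) : ℝ :=
  inftyNorm (absMatrix (geL piv A) * absMatrix (geU piv A)) / inftyNorm A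

/-- The growth factor `ρ_∞(A) = ‖L‖_∞ * ‖U‖_∞ / ‖A‖_∞`. -/
noncomputable def rhoInf {N : ℕ} (piv : PivotRule N) (A : Matrix (Fin N) (Fin N) ℝ) : ℝ :=
  inftyNorm (geL piv A) * inftyNorm (geU piv A) / inftyNorm A

end ButterflyGE

/-! A butterfly matrix is an iterated Kronecker product of plane rotations, and every quantity in
the theorem is multiplicative over Kronecker products. Each product `κ · ρ` therefore becomes, for
almost all angles, a product over the angles of one function of `M = max(|cos|, |sin|)` and `m =
min(|cos|, |sin|)`. Independence turns its expectation into the `n`-th power of a single integral.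

The work lies in showing that elimination respects this structure. If `|cos| ≠ |sin|` at every
level, swapping the two block rows where necessary puts the entry of larger modulus on top. The 2×2
factors `[[1, 0], [-εq/p, 1]]` and `[[p, q], [0, ε/p]]` then tensor to a factorization whose
multipliers have modulus `< 1` and whose `U` is dominated in each row by its diagonal
(`DominantLU.kronTop`). Such a factorization forces the pivots: the column maximum is unique, and
the rook search cannot leave it. Both strategies thus return exactly this `L` and `U`, however ties
are broken (`DominantLU.geState_eq`). The intermediate matrices consist of rows of `U` and of tails
of the sums defining `L * U`, and an induction bounds these tails by `maxNorm U`.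

A pivot rule need not be measurable. The growth factors are therefore replaced, almost everywhere,
by a measurable function of the matrix that reads off the moduli of the tangents of the angles
(`integral_haarButterfly`). -/

namespace ButterflyGE

/-! ### Elimination on a matrix with a dominant factorization -/

/-- A row-permuted triangular factorization `P A = L U` in which every multiplier has modulus less
than one and every diagonal entry of `U` is nonzero and of maximal modulus in its row. -/
structure DominantLU {N : ℕ} (A L U : Matrix (Fin N) (Fin N) ℝ) (σ : Equiv.Perm (Fin N)) : Prop where
  factor : A.submatrix σ id = L * U
  diag_L : ∀ i, L i i = 1
  upper_L : ∀ i j, i < j → L i j = 0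
  lower_L : ∀ i j, j < i → |L i j| < 1
  lower_U : ∀ i j, j < i → U i j = 0
  diag_U : ∀ i, U i i ≠ 0
  row_U : ∀ i j, |U i j| ≤ |U i i|

/-- The part of the product `L * U` coming from the inner indices `l ≥ j`. -/
def tailProd {N : ℕ} (L U : Matrix (Fin N) (Fin N) ℝ) (j : ℕ) (i c : Fin N) : ℝ :=
  ∑ l : Fin N, if j ≤ (l : ℕ) then L i l * U l c else 0

/-- The part of the product `L * U` coming from the inner indices `l < j`. -/
def headProd {N : ℕ} (L U : Matrix (Fin N) (Fin N) ℝ) (j : ℕ) (i c : Fin N) : ℝ :=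
  ∑ l : Fin N, if (l : ℕ) < j then L i l * U l c else 0

theorem headProd_add_tailProd {N : ℕ} (L U : Matrix (Fin N) (Fin N) ℝ) (j : ℕ) (i c : Fin N) :
    headProd L U j i c + tailProd L U j i c = (L * U) i c := by
  rw [headProd, tailProd, ← Finset.sum_add_distrib, Matrix.mul_apply]
  refine Finset.sum_congr rfl fun l _ => ?_
  by_cases h : (l : ℕ) < j
  · simp [h]
  · simp [h, not_lt.mp h]

theorem headProd_zero {N : ℕ} (L U : Matrix (Fin N) (Fin N) ℝ) (i c : Fin N) :
    headProd L U 0 i c = 0 := by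
  simp [headProd]

theorem tailProd_of_le {N : ℕ} (L U : Matrix (Fin N) (Fin N) ℝ) {j : ℕ} (hj : N ≤ j)
    (i c : Fin N) : tailProd L U j i c = 0 :=
  Finset.sum_eq_zero fun l _ => if_neg (by omega)

theorem tailProd_zero {N : ℕ} (L U : Matrix (Fin N) (Fin N) ℝ) (i c : Fin N) :
    tailProd L U 0 i c = (L * U) i c := by
  rw [← headProd_add_tailProd L U 0, headProd_zero, zero_add]

/-- Removing the index `k` from the tail is the row operation of step `k`, with multiplier `L i k`
and pivot row `U k`. -/
theorem tailProd_eq_add_succ {N : ℕ} (L U : Matrix (Fin N) (Fin N) ℝ) (k i c : Fin N) :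
    tailProd L U k i c = L i k * U k c + tailProd L U (k + 1) i c := by
  have h : L i k * U k c = ∑ l, if l = k then L i l * U l c else 0 := by simp
  rw [tailProd, tailProd, h, ← Finset.sum_add_distrib]
  refine Finset.sum_congr rfl fun l _ => ?_
  rcases lt_trichotomy l k with h | h | h
  · have h1 : ¬ ((k : ℕ) ≤ l) := by simpa using h
    have h2 : ¬ ((k : ℕ) + 1 ≤ l) := by omega
    simp [h1, h2, h.ne]
  · subst h; simp
  · have h2 : ((k : ℕ) + 1 ≤ l) := h
    have h1 : ((k : ℕ) ≤ l) := by omega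
    simp [h1, h2, h.ne']

/-- The intermediate matrix of an elimination without interchanges applied to `L * U`. -/
def stage {N : ℕ} (L U : Matrix (Fin N) (Fin N) ℝ) (j : ℕ) (i c : Fin N) : ℝ :=
  if (i : ℕ) < j then U i c else tailProd L U j i c

namespace DominantLU

variable {N : ℕ} {A L U : Matrix (Fin N) (Fin N) ℝ} {σ : Equiv.Perm (Fin N)}

/-- As `L` is unit lower triangular, only `l = k` survives: the pivot row is already final when step
`k` begins. -/
theorem tailProd_self (h : DominantLU A L U σ) (k c : Fin N) : tailProd L U k k c = U k c := by
  rw [tailProd, Finset.sum_eq_single k]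
  · simp [h.diag_L]
  · intro l _ hl
    split_ifs with hk
    · rw [h.upper_L k l (lt_of_le_of_ne hk hl.symm), zero_mul]
    · rfl
  · simp

/-- As `U` is upper triangular, only `l = k` survives, so dividing by the pivot `U k k` yields the
multiplier `L i k`. -/
theorem tailProd_col (h : DominantLU A L U σ) (i k : Fin N) :
    tailProd L U k i k = L i k * U k k := by
  rw [tailProd, Finset.sum_eq_single k]
  · simp
  · intro l _ hl
    split_ifs with hk
    · rw [h.lower_U l k (lt_of_le_of_ne hk hl.symm), mul_zero]
    · rfl
  · simp

theorem stage_self (h : DominantLU A L U σ) (k c : Fin N) : stage L U k k c = U k c := by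
  simp [stage, h.tailProd_self]

theorem stage_col (h : DominantLU A L U σ) {i k : Fin N} (hk : k ≤ i) :
    stage L U k i k = L i k * U k k := by
  have : ¬ (i : ℕ) < k := not_lt.mpr hk
  simp [stage, h.tailProd_col, this]

end DominantLU

theorem perm_le_of_fixes {N : ℕ} {τ : Equiv.Perm (Fin N)} {k : ℕ}
    (hτ : ∀ i : Fin N, (i : ℕ) < k → τ i = i) {i : Fin N} (hi : k ≤ i) : k ≤ τ i := by
  by_contra! hlt
  have := τ.injective (hτ _ hlt)
  rw [this] at hlt
  omega

/-- Partial and rook pivoting both choose the row which the dominant factorization puts first. -/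
theorem DominantLU.pivot_eq {N : ℕ} {A L U : Matrix (Fin N) (Fin N) ℝ} {σ : Equiv.Perm (Fin N)}
    (h : DominantLU A L U σ) {piv : PivotRule N}
    (hpiv : IsPartialPivoting piv ∨ IsRookPivoting piv) {τ : Equiv.Perm (Fin N)} {k : Fin N}
    (hτ : ∀ i : Fin N, (i : ℕ) < k → τ i = i) {V : Matrix (Fin N) (Fin N) ℝ}
    (hV : ∀ i c, V i c = stage L U k (τ i) c) :
    k ≤ (piv V k).1 ∧ τ (piv V k).1 = k ∧ (piv V k).2 = k := by
  -- The candidates in column `k` are `L (τ r) k * U k k`. The strict bound on the multipliers makes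
  -- `U k k` the only one of largest modulus.
  have hcol : ∀ r, IsColMax V k r k → τ r = k := by
    intro r hr
    have hr1 : k ≤ τ r := perm_le_of_fixes hτ hr.1
    have hk : k ≤ τ.symm k := by
      by_contra! hlt
      have := hτ _ hlt
      rw [Equiv.apply_symm_apply] at this
      exact hlt.ne this.symm
    have h1 := hr.2 _ hk
    rw [hV, hV, Equiv.apply_symm_apply, h.stage_col le_rfl, h.stage_col hr1, h.diag_L, one_mul,
      abs_mul] at h1
    rcases hr1.eq_or_lt with h2 | h2
    · exact h2.symm
    · have h3 := h.lower_L _ _ h2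
      have h4 : 0 < |U k k| := abs_pos.mpr (h.diag_U k)
      nlinarith
  rcases hpiv with hp | hp
  · obtain ⟨h1, h2⟩ := hp V k
    exact ⟨h2.1, hcol _ h2, h1⟩
  · obtain ⟨h1, h2, -⟩ := hp V k
    refine ⟨h2.1, ?_⟩
    -- The search never leaves the pivot: a row move would have to beat `U k k` within row `k` of
    -- `U`, and a column maximum is again in the row sent to `k`.
    have key : ∀ r c, RookSearch V k r c → τ r = k ∧ c = k := by
      intro r c hrc
      induction hrc with
      | start r hr => exact ⟨hcol r hr, rfl⟩
      | row r c c' _ _ hlt ih =>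
        obtain ⟨ih1, rfl⟩ := ih
        rw [hV, hV, ih1, h.stage_self, h.stage_self] at hlt
        exact absurd hlt (not_lt.mpr (h.row_U _ _))
      | col r r' c _ hmax _ ih =>
        obtain ⟨ih1, rfl⟩ := ih
        exact ⟨hcol _ hmax, rfl⟩
    exact key _ _ h1

/-- Induction on the number of steps, where `τ` records the interchanges still to be made. It starts
as `σ⁻¹`, each step composes it with the swap that puts its pivot row in place, and after `N` steps
it is the identity. -/
theorem DominantLU.geState_eq {N : ℕ} {A L U : Matrix (Fin N) (Fin N) ℝ} {σ : Equiv.Perm (Fin N)}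
    (h : DominantLU A L U σ) {piv : PivotRule N}
    (hpiv : IsPartialPivoting piv ∨ IsRookPivoting piv) (j : ℕ) (hj : j ≤ N) :
    ∃ τ : Equiv.Perm (Fin N), (∀ i : Fin N, (i : ℕ) < j → τ i = i) ∧
      (∀ i c, (geState piv A j).U i c = stage L U j (τ i) c) ∧
      ∀ i c, (geState piv A j).M i c = if (c : ℕ) < j ∧ c < τ i then L (τ i) c else 0 := by
  induction j with
  | zero =>
    refine ⟨σ.symm, by simp, fun i c => ?_, by simp [geState]⟩
    have := congrFun (congrFun h.factor (σ.symm i)) c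
    simp only [Matrix.submatrix_apply, Equiv.apply_symm_apply, id] at this
    simp [geState, stage, tailProd_zero, this]
  | succ j ih =>
    obtain ⟨τ, hτ, hU, hM⟩ := ih (by omega)
    have hjN : j < N := hj
    set k : Fin N := ⟨j, hjN⟩ with hk
    set s := geState piv A j with hs
    have hgs : geState piv A (j + 1) = geStep piv k s := by
      simp [geState, hjN, hk, hs]
    obtain ⟨hr, hτr, hc⟩ := h.pivot_eq (k := k) hpiv hτ hU
    set r := (piv s.U k).1 with hrdef
    set τ' : Equiv.Perm (Fin N) := (Equiv.swap k r).trans τ with hτ'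
    have hτ'k : τ' k = k := by simp [hτ', hτr]
    have hfix : ∀ i : Fin N, (i : ℕ) < j → τ' i = i := by
      intro i hi
      have h1 : i ≠ k := fun e => by simp [e, hk] at hi
      have h2 : i ≠ r := fun e => by
        rw [e] at hi
        exact absurd hr (not_le.mpr hi)
      simp [hτ', Equiv.swap_apply_of_ne_of_ne h1 h2, hτ i hi]
    have hfix' : ∀ i : Fin N, (i : ℕ) < j + 1 → τ' i = i := by
      intro i hi
      rcases Nat.lt_succ_iff_lt_or_eq.mp hi with h1 | h1
      · exact hfix i h1
      · rw [show i = k from Fin.ext h1, hτ'k]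
    have hV : ∀ i c, s.U (Equiv.swap k r i) (Equiv.swap k (piv s.U k).2 c)
        = stage L U k (τ' i) c := by
      intro i c
      rw [hU, hc]
      simp [hτ', hk]
    have hlt : ∀ i, k < i → k < τ' i := fun i hi => perm_le_of_fixes (k := j + 1) hfix' hi
    -- `τ'` fixes every index up to `k`, so later interchanges only permute rows below the pivot and
    -- the multipliers stay strictly below the diagonal.
    have hlt' : ∀ i, k < τ' i ↔ k < i := by
      intro i
      refine ⟨fun hi => ?_, hlt i⟩
      by_contra! hle
      rw [hfix' i (Nat.lt_succ_of_le hle)] at hi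
      exact absurd hi (not_lt.mpr hle)
    have hm : ∀ i, (if k < i then s.U (Equiv.swap k r i) (Equiv.swap k (piv s.U k).2 k) /
        s.U (Equiv.swap k r k) (Equiv.swap k (piv s.U k).2 k) else 0)
        = if k < τ' i then L (τ' i) k else 0 := by
      intro i
      simp only [hlt']
      split_ifs with hi
      · rw [hV, hV, h.stage_col (hlt i hi).le, hτ'k, h.stage_self,
          mul_div_cancel_right₀ _ (h.diag_U k)]
      · rfl
    refine ⟨τ', hfix', fun i c => ?_, fun i c => ?_⟩
    · rw [hgs]
      simp only [geStep, Matrix.submatrix_apply]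
      rw [← hrdef, hm, hV, hV, hτ'k, h.stage_self]
      rcases lt_trichotomy i k with hi | hi | hi
      · have hi' : (i : ℕ) < j := hi
        have h1 : τ' i = i := hfix i hi'
        have h2 : ¬ k < i := not_lt.mpr hi.le
        have h3 : (i : ℕ) < j + 1 := by omega
        have h4 : (i : ℕ) < k := hi
        rw [h1, if_neg h2, stage, stage, if_pos h3, if_pos h4]
        ring
      · have h3 : (k : ℕ) < j + 1 := Nat.lt_succ_self j
        rw [hi, hτ'k, if_neg (lt_irrefl k), h.stage_self, stage, if_pos h3]
        ring
      · have h1 := hlt i hi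
        have h2 : ¬ ((τ' i : Fin N) : ℕ) < k := not_lt.mpr h1.le
        have h3 : ¬ ((τ' i : Fin N) : ℕ) < j + 1 := not_lt.mpr h1
        have h4 : ((k : Fin N) : ℕ) = j := rfl
        rw [if_pos h1, stage, stage, if_neg h2, if_neg h3, tailProd_eq_add_succ, h4]
        ring
    · rw [hgs]
      simp only [geStep, Matrix.submatrix_apply]
      rw [← hrdef]
      by_cases hck : c = k
      · rw [if_pos hck, hm, hck]
        simp [hk]
      · rw [if_neg hck, hM]
        have h1 : (c : ℕ) ≠ j := fun e => hck (Fin.ext e)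
        have h2 : (c : ℕ) < j + 1 ↔ (c : ℕ) < j := by omega
        simp [h2, hτ']

theorem DominantLU.geL_geU_eq {N : ℕ} {A L U : Matrix (Fin N) (Fin N) ℝ}
    {σ : Equiv.Perm (Fin N)} (h : DominantLU A L U σ) {piv : PivotRule N}
    (hpiv : IsPartialPivoting piv ∨ IsRookPivoting piv) : geL piv A = L ∧ geU piv A = U := by
  obtain ⟨τ, hτ, hU, hM⟩ := h.geState_eq hpiv N le_rfl
  have hid : ∀ i, τ i = i := fun i => hτ i i.isLt
  constructor
  · ext i c
    rw [geL, Matrix.add_apply, hM, hid]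
    rcases lt_trichotomy i c with hi | hi | hi
    · simp [hi.ne, h.upper_L i c hi, not_lt.mpr hi.le]
    · subst hi
      simp [h.diag_L]
    · simp [hi, hi.ne']
  · ext i c
    rw [geU, hU, hid]
    simp [stage]

/-! ### Norms as maxima -/

section Norms

variable {N : ℕ}

open scoped Matrix.Norms.Operator in
theorem inftyNorm_nonneg (A : Matrix (Fin N) (Fin N) ℝ) : 0 ≤ inftyNorm A := by
  exact norm_nonneg A

open scoped Matrix.Norms.Elementwise in
theorem maxNorm_nonneg (A : Matrix (Fin N) (Fin N) ℝ) : 0 ≤ maxNorm A := by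
  exact norm_nonneg A

open scoped Matrix.Norms.Elementwise in
theorem maxNorm_le_iff {A : Matrix (Fin N) (Fin N) ℝ} {r : ℝ} (hr : 0 ≤ r) :
    maxNorm A ≤ r ↔ ∀ i j, |A i j| ≤ r := by
  unfold maxNorm
  rw [Matrix.norm_le_iff hr]
  rfl

theorem abs_le_maxNorm (A : Matrix (Fin N) (Fin N) ℝ) (i j : Fin N) : |A i j| ≤ maxNorm A :=
  (maxNorm_le_iff (maxNorm_nonneg A)).mp le_rfl i j

open scoped Matrix.Norms.Operator in
theorem inftyNorm_le_iff {A : Matrix (Fin N) (Fin N) ℝ} {r : ℝ} (hr : 0 ≤ r) :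
    inftyNorm A ≤ r ↔ ∀ i, ∑ j, |A i j| ≤ r := by
  lift r to NNReal using hr
  unfold inftyNorm
  rw [Matrix.linfty_opNorm_def]
  norm_cast
  rw [Finset.sup_le_iff]
  simp only [Finset.mem_univ, forall_const]
  refine forall_congr' fun i => ?_
  rw [← NNReal.coe_le_coe]
  simp

theorem sum_le_inftyNorm (A : Matrix (Fin N) (Fin N) ℝ) (i : Fin N) :
    ∑ j, |A i j| ≤ inftyNorm A :=
  (inftyNorm_le_iff (inftyNorm_nonneg A)).mp le_rfl i

end Norms

/-- For `≤`, each entry of an intermediate matrix is an entry of `U` or a tail. For `≥`, row `k` of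
`U` already occurs in the matrix before step `k`, so the states `0, …, N - 1` display all of `U`. -/
theorem DominantLU.iSup_maxNorm_geState {N : ℕ} {A L U : Matrix (Fin N) (Fin N) ℝ}
    {σ : Equiv.Perm (Fin N)} (h : DominantLU A L U σ) {piv : PivotRule N}
    (hpiv : IsPartialPivoting piv ∨ IsRookPivoting piv)
    (hbd : ∀ j i c, |tailProd L U j i c| ≤ maxNorm U) :
    ⨆ k : Fin N, maxNorm (geState piv A k).U = maxNorm U := by
  have hle : ∀ k : Fin N, maxNorm (geState piv A k).U ≤ maxNorm U := by
    intro k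
    obtain ⟨τ, -, hU, -⟩ := h.geState_eq hpiv k k.isLt.le
    rw [maxNorm_le_iff (maxNorm_nonneg U)]
    intro i c
    rw [hU, stage]
    split_ifs
    · exact abs_le_maxNorm U _ _
    · exact hbd _ _ _
  have hb : BddAbove (Set.range fun k : Fin N => maxNorm (geState piv A k).U) :=
    ⟨maxNorm U, by rintro _ ⟨k, rfl⟩; exact hle k⟩
  apply le_antisymm
  · exact Real.iSup_le hle (maxNorm_nonneg U)
  · have h0 : 0 ≤ ⨆ k : Fin N, maxNorm (geState piv A k).U :=
      Real.iSup_nonneg fun k => maxNorm_nonneg _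
    rw [maxNorm_le_iff h0]
    intro k c
    refine le_trans ?_ (le_ciSup hb k)
    obtain ⟨τ, -, hU, -⟩ := h.geState_eq hpiv k k.isLt.le
    have := abs_le_maxNorm (geState piv A k).U (τ.symm k) c
    rwa [hU, Equiv.apply_symm_apply, h.stage_self] at this


/-! ### Kronecker products with a `2 × 2` matrix -/

/-- The identification of two consecutive blocks of size `2 ^ n` with a block of size
`2 ^ (n + 1)`. -/
def blockEquiv (n : ℕ) : Fin (2 ^ n) ⊕ Fin (2 ^ n) ≃ Fin (2 ^ (n + 1)) :=
  finSumFinEquiv.trans (finCongr (by rw [pow_succ, mul_two]))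

@[simp] theorem val_blockEquiv_inl {n : ℕ} (a : Fin (2 ^ n)) :
    (blockEquiv n (Sum.inl a) : ℕ) = a := by
  simp [blockEquiv]

@[simp] theorem val_blockEquiv_inr {n : ℕ} (a : Fin (2 ^ n)) :
    (blockEquiv n (Sum.inr a) : ℕ) = 2 ^ n + a := by
  simp [blockEquiv, add_comm]

theorem forall_block {n : ℕ} {p : Fin (2 ^ (n + 1)) → Prop} :
    (∀ i, p i) ↔ (∀ a, p (blockEquiv n (Sum.inl a))) ∧ ∀ a, p (blockEquiv n (Sum.inr a)) := by
  rw [← (blockEquiv n).forall_congr_right, Sum.forall]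

theorem sum_block {n : ℕ} (f : Fin (2 ^ (n + 1)) → ℝ) :
    ∑ i, f i = ∑ a, f (blockEquiv n (Sum.inl a)) + ∑ a, f (blockEquiv n (Sum.inr a)) := by
  rw [← (blockEquiv n).sum_comp, Fintype.sum_sum_type]

/-- The Kronecker product of the matrix `[[a, b], [c, d]]` with `X`. -/
noncomputable def kronTop {n : ℕ} (a b c d : ℝ) (X : Matrix (Fin (2 ^ n)) (Fin (2 ^ n)) ℝ) :
    Matrix (Fin (2 ^ (n + 1))) (Fin (2 ^ (n + 1))) ℝ :=
  Matrix.reindex (blockEquiv n) (blockEquiv n)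
    (Matrix.fromBlocks (a • X) (b • X) (c • X) (d • X))

section Kron

variable {n : ℕ} (a b c d a' b' c' d' : ℝ) (X Y : Matrix (Fin (2 ^ n)) (Fin (2 ^ n)) ℝ)

@[simp] theorem kronTop_inl_inl (i j : Fin (2 ^ n)) :
    kronTop a b c d X (blockEquiv n (Sum.inl i)) (blockEquiv n (Sum.inl j)) = a * X i j := by
  simp [kronTop]

@[simp] theorem kronTop_inl_inr (i j : Fin (2 ^ n)) :
    kronTop a b c d X (blockEquiv n (Sum.inl i)) (blockEquiv n (Sum.inr j)) = b * X i j := by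
  simp [kronTop]

@[simp] theorem kronTop_inr_inl (i j : Fin (2 ^ n)) :
    kronTop a b c d X (blockEquiv n (Sum.inr i)) (blockEquiv n (Sum.inl j)) = c * X i j := by
  simp [kronTop]

@[simp] theorem kronTop_inr_inr (i j : Fin (2 ^ n)) :
    kronTop a b c d X (blockEquiv n (Sum.inr i)) (blockEquiv n (Sum.inr j)) = d * X i j := by
  simp [kronTop]

theorem ext_block {X Y : Matrix (Fin (2 ^ (n + 1))) (Fin (2 ^ (n + 1))) ℝ}
    (h₁ : ∀ i j, X (blockEquiv n (Sum.inl i)) (blockEquiv n (Sum.inl j)) =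
      Y (blockEquiv n (Sum.inl i)) (blockEquiv n (Sum.inl j)))
    (h₂ : ∀ i j, X (blockEquiv n (Sum.inl i)) (blockEquiv n (Sum.inr j)) =
      Y (blockEquiv n (Sum.inl i)) (blockEquiv n (Sum.inr j)))
    (h₃ : ∀ i j, X (blockEquiv n (Sum.inr i)) (blockEquiv n (Sum.inl j)) =
      Y (blockEquiv n (Sum.inr i)) (blockEquiv n (Sum.inl j)))
    (h₄ : ∀ i j, X (blockEquiv n (Sum.inr i)) (blockEquiv n (Sum.inr j)) =
      Y (blockEquiv n (Sum.inr i)) (blockEquiv n (Sum.inr j))) : X = Y := by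
  ext i j
  obtain ⟨x, rfl⟩ := (blockEquiv n).surjective i
  obtain ⟨y, rfl⟩ := (blockEquiv n).surjective j
  rcases x with x | x <;> rcases y with y | y <;> simp [*]

theorem kronTop_mul_kronTop : kronTop a b c d X * kronTop a' b' c' d' Y =
    kronTop (a * a' + b * c') (a * b' + b * d') (c * a' + d * c') (c * b' + d * d') (X * Y) := by
  apply ext_block <;> intro i j <;> simp [Matrix.mul_apply, sum_block, Finset.mul_sum, add_mul,
    ← Finset.sum_add_distrib] <;> refine Finset.sum_congr rfl fun l _ => ?_ <;> ring

theorem transpose_kronTop : (kronTop a b c d X).transpose = kronTop a c b d X.transpose := by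
  apply ext_block <;> intro i j <;> simp

theorem absMatrix_kronTop :
    absMatrix (kronTop a b c d X) = kronTop |a| |b| |c| |d| (absMatrix X) := by
  apply ext_block <;> intro i j <;> simp [absMatrix, abs_mul]

theorem kronTop_one : kronTop 1 0 0 1 (1 : Matrix (Fin (2 ^ n)) (Fin (2 ^ n)) ℝ) = 1 := by
  apply ext_block <;> intro i j <;> simp [Matrix.one_apply]

theorem smul_kronTop (r : ℝ) :
    r • kronTop a b c d X = kronTop (r * a) (r * b) (r * c) (r * d) X := by
  apply ext_block <;> intro i j <;> simp [mul_assoc]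

/-- The absolute row sums of a Kronecker product are the products of those of the factors. -/
theorem inftyNorm_kronTop :
    inftyNorm (kronTop a b c d X) = max (|a| + |b|) (|c| + |d|) * inftyNorm X := by
  have hX := inftyNorm_nonneg X
  have key : ∀ r, 0 ≤ r → (inftyNorm (kronTop a b c d X) ≤ r ↔
      (∀ i, (|a| + |b|) * ∑ j, |X i j| ≤ r) ∧ ∀ i, (|c| + |d|) * ∑ j, |X i j| ≤ r) := by
    intro r hr
    rw [inftyNorm_le_iff hr, forall_block]
    simp only [sum_block, kronTop_inl_inl, kronTop_inl_inr, kronTop_inr_inl, kronTop_inr_inr,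
      abs_mul, ← Finset.mul_sum, ← add_mul]
  have hm : 0 ≤ max (|a| + |b|) (|c| + |d|) := by positivity
  apply le_antisymm
  · rw [key _ (by positivity)]
    constructor <;> intro i <;> gcongr
    · exact le_max_left _ _
    · exact sum_le_inftyNorm X i
    · exact le_max_right _ _
    · exact sum_le_inftyNorm X i
  · obtain ⟨h1, h2⟩ := (key _ (inftyNorm_nonneg _)).mp le_rfl
    rcases hm.eq_or_lt with h0 | h0
    · rw [← h0, zero_mul]
      exact inftyNorm_nonneg _
    · rw [mul_comm, ← le_div_iff₀ h0, inftyNorm_le_iff (div_nonneg (inftyNorm_nonneg _) hm)]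
      intro i
      rw [le_div_iff₀ h0, mul_comm]
      rcases max_choice (|a| + |b|) (|c| + |d|) with h | h <;> rw [h]
      · exact h1 i
      · exact h2 i

theorem maxNorm_kronTop :
    maxNorm (kronTop a b c d X) = max (max |a| |b|) (max |c| |d|) * maxNorm X := by
  have hX := maxNorm_nonneg X
  have key : ∀ r, 0 ≤ r → (maxNorm (kronTop a b c d X) ≤ r ↔
      ∀ i j, (|a| * |X i j| ≤ r ∧ |b| * |X i j| ≤ r) ∧ |c| * |X i j| ≤ r ∧ |d| * |X i j| ≤ r) := by
    intro r hr
    rw [maxNorm_le_iff hr, forall_block]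
    simp only [forall_block, kronTop_inl_inl, kronTop_inl_inr, kronTop_inr_inl, kronTop_inr_inr,
      abs_mul, forall_and]
  have hm : 0 ≤ max (max |a| |b|) (max |c| |d|) := by positivity
  apply le_antisymm
  · rw [key _ (by positivity)]
    intro i j
    have h := abs_le_maxNorm X i j
    refine ⟨⟨?_, ?_⟩, ?_, ?_⟩ <;> refine mul_le_mul ?_ h (abs_nonneg _) hm <;> simp
  · have h1 := (key _ (maxNorm_nonneg _)).mp le_rfl
    rcases hm.eq_or_lt with h0 | h0
    · rw [← h0, zero_mul]
      exact maxNorm_nonneg _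
    · rw [mul_comm, ← le_div_iff₀ h0, maxNorm_le_iff (div_nonneg (maxNorm_nonneg _) hm)]
      intro i j
      rw [le_div_iff₀ h0, mul_comm]
      obtain ⟨⟨h2, h3⟩, h4, h5⟩ := h1 i j
      rcases max_choice (max |a| |b|) (max |c| |d|) with h | h <;> rw [h]
      · rcases max_choice |a| |b| with h | h <;> rw [h] <;> assumption
      · rcases max_choice |c| |d| with h | h <;> rw [h] <;> assumption

end Kron

/-! ### Norms and condition number of butterfly matrices -/

theorem butterfly_succ (n : ℕ) (θ : Fin (n + 1) → ℝ) :
    butterfly (n + 1) θ = kronTop (Real.cos (θ (Fin.last n))) (Real.sin (θ (Fin.last n)))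
      (-Real.sin (θ (Fin.last n))) (Real.cos (θ (Fin.last n)))
      (butterfly n fun i => θ i.castSucc) := by
  rw [butterfly, kronTop, neg_smul]
  rfl

theorem butterfly_mul_transpose (n : ℕ) (θ : Fin n → ℝ) :
    butterfly n θ * (butterfly n θ).transpose = 1 := by
  induction n with
  | zero => simp [butterfly]
  | succ n ih =>
    rw [butterfly_succ, transpose_kronTop, kronTop_mul_kronTop, ih, ← kronTop_one]
    have := Real.cos_sq_add_sin_sq (θ (Fin.last n))
    congr 1 <;> linarith

/-- The larger of the moduli of `cos x` and `sin x`. -/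
noncomputable def maxCS (x : ℝ) : ℝ := max |Real.cos x| |Real.sin x|

/-- The smaller of the moduli of `cos x` and `sin x`. -/
noncomputable def minCS (x : ℝ) : ℝ := min |Real.cos x| |Real.sin x|

theorem maxCS_add_minCS (x : ℝ) : maxCS x + minCS x = |Real.cos x| + |Real.sin x| :=
  max_add_min _ _

theorem minCS_nonneg (x : ℝ) : 0 ≤ minCS x := by unfold minCS; positivity

theorem minCS_le_maxCS (x : ℝ) : minCS x ≤ maxCS x := min_le_max

theorem maxCS_sq_add_minCS_sq (x : ℝ) : maxCS x ^ 2 + minCS x ^ 2 = 1 := by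
  have h := Real.cos_sq_add_sin_sq x
  rw [← sq_abs, ← sq_abs (Real.sin x)] at h
  rcases le_total |Real.cos x| |Real.sin x| with h1 | h1 <;> simp only [maxCS, minCS, max_eq_left,
    max_eq_right, min_eq_left, min_eq_right, h1] <;> linarith

theorem maxCS_pos (x : ℝ) : 0 < maxCS x := by
  have h1 := minCS_nonneg x
  have h2 := minCS_le_maxCS x
  have h3 := maxCS_sq_add_minCS_sq x
  by_contra! h
  nlinarith

theorem inftyNorm_one_of_unique (X : Matrix (Fin (2 ^ 0)) (Fin (2 ^ 0)) ℝ) :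
    inftyNorm X = |X 0 0| := by
  have h : ∀ r, 0 ≤ r → (inftyNorm X ≤ r ↔ |X 0 0| ≤ r) := fun r hr => by
    rw [inftyNorm_le_iff hr]
    simp [Fin.forall_fin_one]
  exact le_antisymm ((h _ (abs_nonneg _)).mpr le_rfl) ((h _ (inftyNorm_nonneg X)).mp le_rfl)

theorem maxNorm_one_of_unique (X : Matrix (Fin (2 ^ 0)) (Fin (2 ^ 0)) ℝ) :
    maxNorm X = |X 0 0| := by
  have h : ∀ r, 0 ≤ r → (maxNorm X ≤ r ↔ |X 0 0| ≤ r) := fun r hr => by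
    rw [maxNorm_le_iff hr]
    simp [Fin.forall_fin_one]
  exact le_antisymm ((h _ (abs_nonneg _)).mpr le_rfl) ((h _ (maxNorm_nonneg X)).mp le_rfl)

theorem maxNorm_butterfly (n : ℕ) (θ : Fin n → ℝ) :
    maxNorm (butterfly n θ) = ∏ i, maxCS (θ i) := by
  induction n with
  | zero => rw [maxNorm_one_of_unique]; simp [butterfly]
  | succ n ih =>
    rw [butterfly_succ, maxNorm_kronTop, ih, Fin.prod_univ_castSucc, mul_comm, abs_neg,
      max_comm |Real.sin _|, max_self, maxCS]

theorem inftyNorm_butterfly (n : ℕ) (θ : Fin n → ℝ) :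
    inftyNorm (butterfly n θ) = ∏ i, (maxCS (θ i) + minCS (θ i)) := by
  induction n with
  | zero => rw [inftyNorm_one_of_unique]; simp [butterfly]
  | succ n ih =>
    rw [butterfly_succ, inftyNorm_kronTop, ih, Fin.prod_univ_castSucc, mul_comm, abs_neg,
      add_comm |Real.sin _|, max_self, maxCS_add_minCS]

theorem inftyNorm_transpose_butterfly (n : ℕ) (θ : Fin n → ℝ) :
    inftyNorm (butterfly n θ).transpose = ∏ i, (maxCS (θ i) + minCS (θ i)) := by
  induction n with
  | zero => rw [inftyNorm_one_of_unique]; simp [butterfly]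
  | succ n ih =>
    rw [butterfly_succ, transpose_kronTop, inftyNorm_kronTop, ih, Fin.prod_univ_castSucc, mul_comm,
      abs_neg, add_comm |Real.sin _|, max_self, maxCS_add_minCS]

theorem kappaInf_butterfly (n : ℕ) (θ : Fin n → ℝ) :
    kappaInf (butterfly n θ) = ∏ i, (maxCS (θ i) + minCS (θ i)) ^ 2 := by
  rw [kappaInf, Matrix.inv_eq_right_inv (butterfly_mul_transpose n θ), inftyNorm_butterfly,
    inftyNorm_transpose_butterfly, Finset.prod_pow, sq]

/-! ### Dominant factorizations under Kronecker products -/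

section Step

variable {n : ℕ} {A L U : Matrix (Fin (2 ^ n)) (Fin (2 ^ n)) ℝ} {σ : Equiv.Perm (Fin (2 ^ n))}
  {B : Matrix (Fin (2 ^ (n + 1))) (Fin (2 ^ (n + 1))) ℝ}
  {τ : Equiv.Perm (Fin (2 ^ (n + 1)))} {p q ε : ℝ}

theorem inl_lt_inl {a b : Fin (2 ^ n)} :
    blockEquiv n (Sum.inl a) < blockEquiv n (Sum.inl b) ↔ a < b := by
  rw [Fin.lt_def, Fin.lt_def]
  simp

theorem inr_lt_inr {a b : Fin (2 ^ n)} :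
    blockEquiv n (Sum.inr a) < blockEquiv n (Sum.inr b) ↔ a < b := by
  rw [Fin.lt_def, Fin.lt_def]
  simp

theorem inl_lt_inr (a b : Fin (2 ^ n)) :
    blockEquiv n (Sum.inl a) < blockEquiv n (Sum.inr b) := by
  rw [Fin.lt_def, val_blockEquiv_inl, val_blockEquiv_inr]
  omega

/-- The 2×2 block factors because `p² + q² = 1` turns its Schur complement `εp + εq²/p` into `ε/p`.
The lower left block of the new `L` is `-εq/p` times `L`, diagonal included, so its entries are at
most `|q/p| < 1` in modulus. -/
theorem DominantLU.kronTop (h : DominantLU A L U σ) (hp : p ≠ 0) (hqp : |q| < |p|)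
    (hpq : p ^ 2 + q ^ 2 = 1) (hε : |ε| = 1)
    (hB : B.submatrix τ id = kronTop p q (-ε * q) (ε * p) (A.submatrix σ id)) :
    DominantLU B (kronTop 1 0 (-ε * q / p) 1 L) (kronTop p q 0 (ε / p) U) τ where
  factor := by
    rw [hB, h.factor, kronTop_mul_kronTop]
    congr 1
    · ring
    · ring
    · field_simp; ring
    · field_simp
      linear_combination ε * hpq
  diag_L := by
    rw [forall_block]
    simp [h.diag_L]
  upper_L := by
    simp only [forall_block, inl_lt_inl, inr_lt_inr]
    refine ⟨fun a => ⟨fun b hab => ?_, fun b _ => ?_⟩, fun a => ⟨fun b hab => ?_, fun b hab => ?_⟩⟩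
    · simp [h.upper_L a b hab]
    · simp
    · exact absurd hab (inl_lt_inr b a).asymm
    · simp [h.upper_L a b hab]
  lower_L := by
    have hm : |(-ε * q / p)| < 1 := by
      rw [abs_div, abs_mul, abs_neg, hε, one_mul, div_lt_one (abs_pos.mpr hp)]
      exact hqp
    simp only [forall_block, inl_lt_inl, inr_lt_inr]
    refine ⟨fun a => ⟨fun b hab => ?_, fun b hab => ?_⟩, fun a => ⟨fun b _ => ?_, fun b hab => ?_⟩⟩
    · simpa using h.lower_L a b hab
    · exact absurd hab (inl_lt_inr a b).asymm
    · rw [kronTop_inr_inl, abs_mul]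
      have h1 : |L a b| ≤ 1 := by
        rcases lt_trichotomy a b with h2 | h2 | h2
        · simp [h.upper_L a b h2]
        · simp [h2, h.diag_L]
        · exact (h.lower_L a b h2).le
      exact lt_of_le_of_lt (mul_le_of_le_one_right (abs_nonneg _) h1) hm
    · simpa using h.lower_L a b hab
  lower_U := by
    simp only [forall_block, inl_lt_inl, inr_lt_inr]
    refine ⟨fun a => ⟨fun b hab => ?_, fun b hab => ?_⟩, fun a => ⟨fun b _ => ?_, fun b hab => ?_⟩⟩
    · simp [h.lower_U a b hab]
    · exact absurd hab (inl_lt_inr a b).asymm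
    · simp
    · simp [h.lower_U a b hab]
  diag_U := by
    have : ε ≠ 0 := by rintro rfl; simp at hε
    simp [forall_block, h.diag_U, hp, this]
  row_U := by
    simp only [forall_block, kronTop_inl_inl, kronTop_inl_inr, kronTop_inr_inl, kronTop_inr_inr,
      abs_mul, abs_zero, zero_mul]
    refine ⟨fun a => ⟨fun b => ?_, fun b => ?_⟩, fun a => ⟨fun b => by positivity, fun b => ?_⟩⟩
    · exact mul_le_mul_of_nonneg_left (h.row_U a b) (abs_nonneg _)
    · exact mul_le_mul hqp.le (h.row_U a b) (abs_nonneg _) (abs_nonneg _)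
    · exact mul_le_mul_of_nonneg_left (h.row_U a b) (abs_nonneg _)

theorem le_add_val_iff {n j : ℕ} (b : Fin (2 ^ n)) :
    (j ≤ 2 ^ n + (b : ℕ)) = (j - 2 ^ n ≤ (b : ℕ)) := by
  rw [Nat.sub_le_iff_le_add']

theorem add_val_lt_iff {n j : ℕ} (b : Fin (2 ^ n)) :
    (2 ^ n + (b : ℕ) < j) = ((b : ℕ) < j - 2 ^ n) := by
  rw [Nat.lt_sub_iff_add_lt']

theorem sum_ite_mul_left_mul (P : Fin (2 ^ n) → Prop) [DecidablePred P] (x y : ℝ)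
    (f g : Fin (2 ^ n) → ℝ) :
    (∑ l, if P l then x * f l * (y * g l) else 0) = x * y * ∑ l, if P l then f l * g l else 0 := by
  rw [Finset.mul_sum]
  refine Finset.sum_congr rfl fun l _ => ?_
  split_ifs <;> ring

theorem abs_convex_le {x y u v G : ℝ} (hu : 0 ≤ u) (hv : 0 ≤ v) (huv : u + v = 1)
    (hx : |x| ≤ G) (hy : |y| ≤ G) : |u * x + v * y| ≤ G := by
  calc |u * x + v * y| ≤ |u * x| + |v * y| := abs_add_le _ _
    _ = u * |x| + v * |y| := by rw [abs_mul, abs_mul, abs_of_nonneg hu, abs_of_nonneg hv]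
    _ ≤ u * G + v * G := by gcongr
    _ = G := by rw [← add_mul, huv, one_mul]

/-- Bounds on head and tail parts of `L * U` propagate to the Kronecker products. -/
theorem abs_headProd_tailProd_kronTop {G : ℝ} (hp : p ≠ 0) (hqp : |q| < |p|)
    (hpq : p ^ 2 + q ^ 2 = 1) (hε : |ε| = 1)
    (hG : ∀ j i c, |headProd L U j i c| ≤ G ∧ |tailProd L U j i c| ≤ G) (j : ℕ)
    (i c : Fin (2 ^ (n + 1))) :
    |headProd (kronTop 1 0 (-ε * q / p) 1 L) (kronTop p q 0 (ε / p) U) j i c| ≤ G / |p| ∧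
    |tailProd (kronTop 1 0 (-ε * q / p) 1 L) (kronTop p q 0 (ε / p) U) j i c| ≤ G / |p| := by
  have hp0 : 0 < |p| := abs_pos.mpr hp
  have hp1 : |p| ≤ 1 := abs_le_one_iff_mul_self_le_one.mpr (by nlinarith)
  have hq1 : |q| ≤ 1 := hqp.le.trans hp1
  have hG0 : ∀ {x : ℝ}, |x| ≤ G → 0 ≤ G := fun h => (abs_nonneg _).trans h
  have hsmall : ∀ {a x : ℝ}, |a| ≤ 1 → |x| ≤ G → |a * x| ≤ G / |p| := by
    intro a x ha hx
    have := hG0 hx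
    rw [abs_mul, le_div_iff₀ hp0]
    calc |a| * |x| * |p| ≤ 1 * G * 1 := by gcongr
      _ = G := by ring
  have hdiv : ∀ {x : ℝ}, |x| ≤ G → |ε / p * x| ≤ G / |p| := by
    intro x hx
    rw [abs_mul, abs_div, hε, div_mul_eq_mul_div, one_mul]
    gcongr
  have hmp : |(-ε * q / p * p)| ≤ 1 := by
    rw [div_mul_cancel₀ _ hp, abs_mul, abs_neg, hε, one_mul]
    exact hq1
  have hhead : ∀ a b j, headProd L U j a b = (L * U) a b - tailProd L U j a b := fun a b j => by
    rw [← headProd_add_tailProd L U j, add_sub_cancel_right]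
  have hLU : ∀ a b, |(L * U) a b| ≤ G := fun a b => by
    rw [← tailProd_zero]; exact (hG 0 a b).2
  revert i c
  simp only [forall_block, headProd, tailProd, sum_block, kronTop_inl_inl, kronTop_inl_inr,
    kronTop_inr_inl, kronTop_inr_inr, val_blockEquiv_inl, val_blockEquiv_inr, le_add_val_iff,
    add_val_lt_iff, sum_ite_mul_left_mul]
  have hhead' : ∀ (j : ℕ) (a b : Fin (2 ^ n)),
      (∑ l : Fin (2 ^ n), if (l : ℕ) < j then L a l * U l b else 0) = headProd L U j a b := fun _ _ _ => rfl
  have htail' : ∀ (j : ℕ) (a b : Fin (2 ^ n)),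
      (∑ l : Fin (2 ^ n), if j ≤ (l : ℕ) then L a l * U l b else 0) = tailProd L U j a b := fun _ _ _ => rfl
  simp only [hhead', htail', zero_mul, mul_zero, add_zero, one_mul]
  refine ⟨fun a => ⟨fun b => ⟨?_, ?_⟩, fun b => ⟨?_, ?_⟩⟩,
    fun a => ⟨fun b => ⟨?_, ?_⟩, fun b => ?_⟩⟩
  · exact hsmall hp1 (hG _ _ _).1
  · exact hsmall hp1 (hG _ _ _).2
  · exact hsmall hq1 (hG _ _ _).1
  · exact hsmall hq1 (hG _ _ _).2
  · exact hsmall hmp (hG _ _ _).1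
  · exact hsmall hmp (hG _ _ _).2
  -- Only the lower right block mixes two sums. With `H` and `T` the head and tail of `L * U`, the
  -- bracket is, for `j ≤ 2 ^ n`, `-q² H` (head) or `p² (L * U) + q² H` (tail). For `j ≥ 2 ^ n` it
  -- is `p² H - q² T` (head) or `T` (tail), with `H` and `T` taken at `j - 2 ^ n`. Up to sign these
  -- are convex combinations of bounded terms. The tail bound calls on `H`, which is why heads are
  -- carried along.
  · have e : ∀ x y, -ε * q / p * q * x + ε / p * y = ε / p * (y - q ^ 2 * x) := fun x y => by ring
    rw [e, e]
    rcases le_total j (2 ^ n) with hj | hj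
    · rw [Nat.sub_eq_zero_of_le hj, headProd_zero, tailProd_zero]
      refine ⟨hdiv ?_, hdiv ?_⟩
      · have := abs_convex_le (sq_nonneg p) (sq_nonneg q) hpq
          (x := 0) (by simpa using (abs_nonneg _).trans (hLU a b)) (hG j a b).1
        rwa [mul_zero, zero_add, ← abs_neg, ← zero_sub] at this
      · have := abs_convex_le (sq_nonneg p) (sq_nonneg q) hpq (hLU a b) (hG j a b).1
        rw [hhead] at this
        convert this using 2
        linear_combination (-(L * U) a b) * hpq
    · rw [tailProd_of_le L U hj, mul_zero, sub_zero, hhead a b j, tailProd_of_le L U hj, sub_zero,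
        ← headProd_add_tailProd L U (j - 2 ^ n)]
      refine ⟨hdiv ?_, hdiv (hG _ a b).2⟩
      have := abs_convex_le (sq_nonneg p) (sq_nonneg q) hpq (hG (j - 2 ^ n) a b).1
        (y := -tailProd L U (j - 2 ^ n) a b) (by rw [abs_neg]; exact (hG _ a b).2)
      convert this using 2
      linear_combination (-headProd L U (j - 2 ^ n) a b) * hpq

end Step

/-! ### The factors and growth of butterfly matrices -/

/-- The rotation block of a butterfly matrix, with its rows possibly interchanged so that the entry
of larger modulus is on top. -/
theorem exists_block_pivot {n : ℕ} (x : ℝ) (hx : |Real.cos x| ≠ |Real.sin x|)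
    (A : Matrix (Fin (2 ^ n)) (Fin (2 ^ n)) ℝ) (σ : Equiv.Perm (Fin (2 ^ n))) :
    ∃ (p q ε : ℝ) (τ : Equiv.Perm (Fin (2 ^ (n + 1)))), |p| = maxCS x ∧ |q| = minCS x ∧
      |q| < |p| ∧ p ^ 2 + q ^ 2 = 1 ∧ |ε| = 1 ∧
      (kronTop (Real.cos x) (Real.sin x) (-Real.sin x) (Real.cos x) A).submatrix τ id =
        kronTop p q (-ε * q) (ε * p) (A.submatrix σ id) := by
  have h := Real.cos_sq_add_sin_sq x
  rcases hx.lt_or_gt with hlt | hlt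
  -- Interchanging the block rows puts `-sin x` on top and flips the sign of the determinant of the
  -- rotation, which is `ε`.
  · refine ⟨-Real.sin x, Real.cos x, -1,
      (blockEquiv n).symm.trans (((Equiv.sumCongr σ σ).trans (Equiv.sumComm _ _)).trans
        (blockEquiv n)), ?_, ?_, ?_, ?_, by simp, ?_⟩
    · rw [maxCS, abs_neg, max_eq_right hlt.le]
    · rw [minCS, min_eq_left hlt.le]
    · rwa [abs_neg]
    · linarith
    · apply ext_block <;> intro i j <;> simp
  · refine ⟨Real.cos x, Real.sin x, 1,
      (blockEquiv n).symm.trans ((Equiv.sumCongr σ σ).trans (blockEquiv n)), ?_, ?_, hlt, h,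
        by simp, ?_⟩
    · rw [maxCS, max_eq_left hlt.le]
    · rw [minCS, min_eq_right hlt.le]
    · apply ext_block <;> intro i j <;> simp

/-- Induction on `n`, one Kronecker factor at a time. The only question in each norm is which row of
the 2×2 factor has the larger absolute sum: the lower for `L` and for `|L||U|`, the upper for `U`.
-/
theorem exists_dominantLU_butterfly (n : ℕ) (θ : Fin n → ℝ)
    (hθ : ∀ i, |Real.cos (θ i)| ≠ |Real.sin (θ i)|) :
    ∃ (L U : Matrix (Fin (2 ^ n)) (Fin (2 ^ n)) ℝ) (σ : Equiv.Perm (Fin (2 ^ n))),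
      DominantLU (butterfly n θ) L U σ ∧
      (∀ j i c, |headProd L U j i c| ≤ maxNorm U ∧ |tailProd L U j i c| ≤ maxNorm U) ∧
      maxNorm L = 1 ∧ maxNorm U = ∏ i, 1 / maxCS (θ i) ∧
      inftyNorm L = ∏ i, (1 + minCS (θ i) / maxCS (θ i)) ∧
      inftyNorm U = ∏ i, (maxCS (θ i) + minCS (θ i)) ∧
      inftyNorm (absMatrix L * absMatrix U) =
        ∏ i, (minCS (θ i) + (1 + minCS (θ i) ^ 2) / maxCS (θ i)) := by
  induction n with
  | zero =>
    refine ⟨1, 1, 1, ⟨by simp [butterfly], by simp, ?_, ?_, ?_, by simp, ?_⟩, ?_, ?_⟩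
    · intro i j hij; simp [hij.ne]
    · intro i j hij; simp [hij.ne']
    · intro i j hij; simp [hij.ne']
    · intro i j
      rw [Subsingleton.elim (α := Fin 1) i j]
    · intro j i c
      have : Subsingleton (Fin (2 ^ 0)) := inferInstanceAs (Subsingleton (Fin 1))
      rw [maxNorm_one_of_unique]
      have hi : i = 0 := Subsingleton.elim (α := Fin 1) i 0
      have hc : c = 0 := Subsingleton.elim (α := Fin 1) c 0
      subst hi hc
      constructor
      · rw [headProd, Fintype.sum_subsingleton _ (0 : Fin (2 ^ 0))]
        split_ifs <;> simp
      · rw [tailProd, Fintype.sum_subsingleton _ (0 : Fin (2 ^ 0))]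
        split_ifs <;> simp
    · simp [maxNorm_one_of_unique, inftyNorm_one_of_unique, absMatrix]
  | succ n ih =>
    obtain ⟨L, U, σ, h, hG, hL, hU, hLi, hUi, hLU⟩ :=
      ih (fun i => θ i.castSucc) fun i => hθ _
    set x := θ (Fin.last n) with hx
    obtain ⟨p, q, ε, τ, hpm, hqm, hqp, hpq, hε, hB⟩ :=
      exists_block_pivot x (hθ _) (butterfly n fun i => θ i.castSucc) σ
    have hM0 := maxCS_pos x
    have hm0 := minCS_nonneg x
    have hmM := minCS_le_maxCS x
    have hsq := maxCS_sq_add_minCS_sq x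
    have hp : p ≠ 0 := by rintro rfl; rw [abs_zero] at hpm; exact hM0.ne hpm
    have hM1 : maxCS x ≤ 1 := by nlinarith
    have h1M : 1 ≤ 1 / maxCS x := by rw [le_div_iff₀ hM0]; linarith
    have hmul : |(-ε * q / p)| = minCS x / maxCS x := by
      rw [abs_div, abs_mul, abs_neg, hε, one_mul, hpm, hqm]
    have hd : |ε / p| = 1 / maxCS x := by rw [abs_div, hε, hpm]
    have hr1 : minCS x / maxCS x ≤ 1 := by rw [div_le_one hM0]; exact hmM
    have hr0 : 0 ≤ minCS x / maxCS x := by positivity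
    have hmaxU : maxNorm (kronTop p q 0 (ε / p) U) = maxNorm U / |p| := by
      rw [maxNorm_kronTop, hpm, hqm, hd, abs_zero, max_eq_left hmM, max_eq_right (one_div_pos.mpr hM0).le,
        max_eq_right (by linarith)]
      ring
    refine ⟨_, _, τ, butterfly_succ n θ ▸ h.kronTop hp hqp hpq hε hB, ?_, ?_, ?_, ?_, ?_, ?_⟩
    · intro j i c
      rw [hmaxU]
      exact abs_headProd_tailProd_kronTop hp hqp hpq hε hG j i c
    · rw [maxNorm_kronTop, hL, hmul]
      simp [hr1]
    · rw [hmaxU, hU, Fin.prod_univ_castSucc, hpm]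
      ring
    · rw [inftyNorm_kronTop, hLi, Fin.prod_univ_castSucc, hmul, ← hx, mul_comm]
      congr 1
      rw [abs_one, abs_zero, add_zero, max_eq_right (by linarith), add_comm]
    · rw [inftyNorm_kronTop, hUi, Fin.prod_univ_castSucc, hd, ← hx, mul_comm, hpm, hqm]
      congr 1
      rw [abs_zero, zero_add, max_eq_left]
      -- The upper row sum wins since `M (M + m) ≥ M² + m² = 1`, by `m ≤ M`.
      rw [div_le_iff₀ hM0]
      nlinarith
    · rw [absMatrix_kronTop, absMatrix_kronTop, kronTop_mul_kronTop, inftyNorm_kronTop, hLU,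
        Fin.prod_univ_castSucc, hmul, hd, ← hx, mul_comm, hpm, hqm]
      congr 1
      simp only [abs_one, abs_zero, one_mul, zero_mul, mul_zero, add_zero]
      rw [div_mul_cancel₀ _ hM0.ne', abs_of_pos hM0, abs_of_nonneg hm0,
        abs_of_nonneg (by positivity), max_eq_right]
      · field_simp
        ring
      · have : 0 ≤ minCS x / maxCS x * minCS x := by positivity
        linarith

theorem growth_butterfly (n : ℕ) (θ : Fin n → ℝ)
    (hθ : ∀ i, |Real.cos (θ i)| ≠ |Real.sin (θ i)|) {piv : PivotRule (2 ^ n)}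
    (hpiv : IsPartialPivoting piv ∨ IsRookPivoting piv) :
    kappaInf (butterfly n θ) * rho piv (butterfly n θ) =
      ∏ i, ((maxCS (θ i) + minCS (θ i)) ^ 2 / maxCS (θ i) ^ 2) ∧
    kappaInf (butterfly n θ) * rhoO piv (butterfly n θ) =
      ∏ i, ((maxCS (θ i) + minCS (θ i)) * (minCS (θ i) + (1 + minCS (θ i) ^ 2) / maxCS (θ i))) ∧
    kappaInf (butterfly n θ) * rhoInf piv (butterfly n θ) =
      ∏ i, ((maxCS (θ i) + minCS (θ i)) ^ 2 * (1 + minCS (θ i) / maxCS (θ i))) := by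
  obtain ⟨L, U, σ, h, hG, hL, hU, hLi, hUi, hLU⟩ := exists_dominantLU_butterfly n θ hθ
  obtain ⟨hgL, hgU⟩ := h.geL_geU_eq hpiv
  have hM : ∀ i, maxCS (θ i) ≠ 0 := fun i => (maxCS_pos _).ne'
  have hS : ∀ i, maxCS (θ i) + minCS (θ i) ≠ 0 := fun i =>
    (add_pos_of_pos_of_nonneg (maxCS_pos _) (minCS_nonneg _)).ne'
  rw [kappaInf_butterfly, rho, rhoO, rhoInf, h.iSup_maxNorm_geState hpiv fun j i c => (hG j i c).2,
    hgL, hgU, hL, hU, hLi, hUi, hLU, maxNorm_butterfly, inftyNorm_butterfly, one_mul,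
    ← Finset.prod_mul_distrib, ← Finset.prod_div_distrib, ← Finset.prod_div_distrib,
    ← Finset.prod_div_distrib, ← Finset.prod_mul_distrib, ← Finset.prod_mul_distrib,
    ← Finset.prod_mul_distrib]
  refine ⟨Finset.prod_congr rfl fun i _ => ?_, Finset.prod_congr rfl fun i _ => ?_,
    Finset.prod_congr rfl fun i _ => ?_⟩ <;> have := hM i <;> have := hS i <;> field_simp


/-! ### Integrals against the uniform angle -/

theorem continuous_maxCS : Continuous maxCS := by unfold maxCS; fun_prop

theorem continuous_minCS : Continuous minCS := by unfold minCS; fun_prop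

theorem uniformAngle_eq : uniformAngle =
    (ENNReal.ofReal (2 * Real.pi))⁻¹ • volume.restrict (Set.Ico 0 (2 * Real.pi)) := by
  rw [uniformAngle, ProbabilityTheory.cond, Real.volume_Ico, sub_zero]

theorem integral_uniformAngle (f : ℝ → ℝ) :
    ∫ x, f x ∂uniformAngle = (2 * Real.pi)⁻¹ * ∫ x in (0 : ℝ)..2 * Real.pi, f x := by
  have hpi : 0 ≤ 2 * Real.pi := by positivity
  rw [uniformAngle_eq, integral_smul_measure, integral_Ico_eq_integral_Ioc,
    intervalIntegral.integral_of_le hpi, ENNReal.toReal_inv, ENNReal.toReal_ofReal hpi, smul_eq_mul]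

theorem integrable_uniformAngle {f : ℝ → ℝ} (hf : Continuous f) : Integrable f uniformAngle := by
  rw [uniformAngle_eq]
  refine Integrable.smul_measure ?_ ?_
  · exact (hf.integrableOn_Icc (a := 0) (b := 2 * Real.pi)).mono_set Set.Ico_subset_Icc_self
  · simp [Real.pi_pos]

/-- The constant 8 counts four periods, each split by evenness into two halves. -/
theorem integral_two_pi_of_symm {f : ℝ → ℝ} (hf : Continuous f)
    (hper : Function.Periodic f (Real.pi / 2)) (heven : ∀ x, f (-x) = f x) :
    ∫ x in (0 : ℝ)..2 * Real.pi, f x = 8 * ∫ x in (0 : ℝ)..Real.pi / 4, f x := by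
  have h1 := hper.intervalIntegral_add_zsmul_eq 4 0 fun a b => hf.intervalIntegrable a b
  have h2 := hper.intervalIntegral_add_eq 0 (-(Real.pi / 4))
  have h3 := intervalIntegral.integral_comp_neg (a := 0) (b := Real.pi / 4) f
  have h4 := intervalIntegral.integral_add_adjacent_intervals
    (hf.intervalIntegrable (μ := volume) (-(Real.pi / 4)) 0) (hf.intervalIntegrable 0 (Real.pi / 4))
  simp only [heven, neg_zero] at h3
  have e1 : (0 : ℝ) + (4 : ℤ) • (Real.pi / 2) = 2 * Real.pi := by
    rw [zsmul_eq_mul]; push_cast; ring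
  have e2 : -(Real.pi / 4) + Real.pi / 2 = Real.pi / 4 := by ring
  rw [e1, h2, e2, ← h4, ← h3, zsmul_eq_mul] at h1
  rw [h1]
  push_cast
  ring

theorem maxCS_periodic (x : ℝ) : maxCS (x + Real.pi / 2) = maxCS x := by
  rw [maxCS, Real.cos_add_pi_div_two, Real.sin_add_pi_div_two, abs_neg, max_comm, maxCS]

theorem minCS_periodic (x : ℝ) : minCS (x + Real.pi / 2) = minCS x := by
  rw [minCS, Real.cos_add_pi_div_two, Real.sin_add_pi_div_two, abs_neg, min_comm, minCS]

theorem maxCS_neg (x : ℝ) : maxCS (-x) = maxCS x := by simp [maxCS]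

theorem minCS_neg (x : ℝ) : minCS (-x) = minCS x := by simp [minCS]

theorem sin_le_cos_of_mem {x : ℝ} (hx : x ∈ Set.Icc 0 (Real.pi / 4)) :
    0 ≤ Real.sin x ∧ Real.sin x ≤ Real.cos x := by
  have hpi := Real.pi_pos
  refine ⟨Real.sin_nonneg_of_nonneg_of_le_pi hx.1 (by linarith [hx.2]), ?_⟩
  rw [← Real.cos_pi_div_two_sub]
  exact Real.cos_le_cos_of_nonneg_of_le_pi hx.1 (by linarith [hx.1]) (by linarith [hx.2])

theorem maxCS_of_mem {x : ℝ} (hx : x ∈ Set.Icc 0 (Real.pi / 4)) : maxCS x = Real.cos x := by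
  obtain ⟨h1, h2⟩ := sin_le_cos_of_mem hx
  rw [maxCS, abs_of_nonneg h1, abs_of_nonneg (h1.trans h2), max_eq_left h2]

theorem minCS_of_mem {x : ℝ} (hx : x ∈ Set.Icc 0 (Real.pi / 4)) : minCS x = Real.sin x := by
  obtain ⟨h1, h2⟩ := sin_le_cos_of_mem hx
  rw [minCS, abs_of_nonneg h1, abs_of_nonneg (h1.trans h2), min_eq_right h2]

/-- A function of `maxCS` and `minCS` is integrated over the circle by means of a primitive on
`[0, π/4]`. -/
theorem integral_uniformAngle_eq_sub (F : ℝ → ℝ → ℝ)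
    (hF : Continuous fun x => F (maxCS x) (minCS x)) (G : ℝ → ℝ)
    (hG : ∀ x, Real.cos x ≠ 0 → HasDerivAt G (F (Real.cos x) (Real.sin x)) x) :
    ∫ x, F (maxCS x) (minCS x) ∂uniformAngle = 4 / Real.pi * (G (Real.pi / 4) - G 0) := by
  have hpi := Real.pi_pos
  rw [integral_uniformAngle, integral_two_pi_of_symm hF
    (fun x => by simp only [maxCS_periodic, minCS_periodic])
    (fun x => by simp only [maxCS_neg, minCS_neg]),
    intervalIntegral.integral_eq_sub_of_hasDerivAt (f := G) (fun x hx => ?_)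
      (hF.intervalIntegrable _ _)]
  · field_simp; ring
  · rw [Set.uIcc_of_le (by positivity)] at hx
    rw [maxCS_of_mem hx, minCS_of_mem hx]
    refine hG x ?_
    rw [← maxCS_of_mem hx]
    exact (maxCS_pos x).ne'

theorem log_cos_pi_div_four : Real.log (Real.cos (Real.pi / 4)) = -(Real.log 2 / 2) := by
  rw [Real.cos_pi_div_four, Real.log_div (by positivity) (by norm_num), Real.log_sqrt (by norm_num)]
  ring

theorem hasDerivAt_log_cos {x : ℝ} (hx : Real.cos x ≠ 0) :
    HasDerivAt (fun x => Real.log (Real.cos x)) (-Real.sin x / Real.cos x) x :=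
  (Real.hasDerivAt_cos x).log hx

theorem cos_sq_pi_div_four : Real.cos (Real.pi / 4) ^ 2 = 1 / 2 := by
  rw [Real.cos_pi_div_four, div_pow, Real.sq_sqrt (by norm_num)]; norm_num

theorem sin_pi_div_four_eq : Real.sin (Real.pi / 4) = Real.cos (Real.pi / 4) := by
  rw [Real.cos_pi_div_four, Real.sin_pi_div_four]

/-- The contribution of one angle to the condition number. -/
noncomputable def kappaFactor (M m : ℝ) : ℝ := (M + m) ^ 2

/-- The contribution of one angle to `κ_∞ ρ`. -/
noncomputable def rhoFactor (M m : ℝ) : ℝ := (M + m) ^ 2 / M ^ 2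

/-- The contribution of one angle to `κ_∞ ρ_o`. -/
noncomputable def rhoOFactor (M m : ℝ) : ℝ := (M + m) * (m + (1 + m ^ 2) / M)

/-- The contribution of one angle to `κ_∞ ρ_∞`. -/
noncomputable def rhoInfFactor (M m : ℝ) : ℝ := (M + m) ^ 2 * (1 + m / M)

theorem continuous_kappaFactor : Continuous fun x => kappaFactor (maxCS x) (minCS x) := by
  have h1 := continuous_maxCS
  have h2 := continuous_minCS
  unfold kappaFactor
  fun_prop

theorem continuous_rhoFactor : Continuous fun x => rhoFactor (maxCS x) (minCS x) := by
  have h1 := continuous_maxCS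
  have h2 := continuous_minCS
  exact ((h1.add h2).pow 2).div (h1.pow 2) fun x => pow_ne_zero 2 (maxCS_pos x).ne'

theorem continuous_rhoOFactor : Continuous fun x => rhoOFactor (maxCS x) (minCS x) := by
  have h1 := continuous_maxCS
  have h2 := continuous_minCS
  exact (h1.add h2).mul (h2.add ((continuous_const.add (h2.pow 2)).div h1
    fun x => (maxCS_pos x).ne'))

theorem continuous_rhoInfFactor : Continuous fun x => rhoInfFactor (maxCS x) (minCS x) := by
  have h1 := continuous_maxCS
  have h2 := continuous_minCS
  exact ((h1.add h2).pow 2).mul (continuous_const.add (h2.div h1 fun x => (maxCS_pos x).ne'))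

/-- `(cos + sin)² = 1 + 2 sin cos`, with primitive `x + sin²`. -/
theorem integral_kappaFactor :
    ∫ x, kappaFactor (maxCS x) (minCS x) ∂uniformAngle = 1 + 2 / Real.pi := by
  rw [integral_uniformAngle_eq_sub kappaFactor continuous_kappaFactor
    (fun x => x + Real.sin x ^ 2) fun x _ => ?_]
  · have hpi := Real.pi_ne_zero
    simp only [sin_pi_div_four_eq, cos_sq_pi_div_four, Real.sin_zero]
    field_simp
    ring
  · refine HasDerivAt.congr_deriv ((hasDerivAt_id x).add ((Real.hasDerivAt_sin x).pow 2)) ?_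
    have h := Real.cos_sq_add_sin_sq x
    rw [kappaFactor]
    push_cast
    linear_combination -h

/-- The integrand is `(1 + tan)² = sec² + 2 tan`. The factor 2 split off from the value, here and in
the next two integrals, becomes the power `N ^ 1`. -/
theorem integral_rhoFactor : ∫ x, rhoFactor (maxCS x) (minCS x) ∂uniformAngle =
    2 * (2 / Real.pi * (1 + Real.log 2)) := by
  rw [integral_uniformAngle_eq_sub rhoFactor continuous_rhoFactor
    (fun x => Real.tan x - 2 * Real.log (Real.cos x)) fun x hx => ?_]
  · have hpi := Real.pi_ne_zero
    simp only [log_cos_pi_div_four, Real.tan_pi_div_four, Real.tan_zero, Real.cos_zero,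
      Real.log_one]
    field_simp
    ring
  · refine HasDerivAt.congr_deriv ((Real.hasDerivAt_tan hx).sub ((hasDerivAt_log_cos hx).const_mul 2)) ?_
    have h := Real.cos_sq_add_sin_sq x
    rw [rhoFactor]
    field_simp
    linear_combination -h

/-- Since `sin³ / cos = tan - sin cos`, the integrand reduces to `1 + 2 sin² + 2 tan`. -/
theorem integral_rhoOFactor : ∫ x, rhoOFactor (maxCS x) (minCS x) ∂uniformAngle =
    2 * (1 + (Real.log 4 - 1) / Real.pi) := by
  rw [integral_uniformAngle_eq_sub rhoOFactor continuous_rhoOFactor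
    (fun x => 2 * x - Real.sin x * Real.cos x - 2 * Real.log (Real.cos x)) fun x hx => ?_]
  · have hpi := Real.pi_ne_zero
    have h4 : Real.log 4 = 2 * Real.log 2 := by
      rw [show (4 : ℝ) = 2 ^ 2 by norm_num, Real.log_pow]; norm_num
    have h5 := cos_sq_pi_div_four
    simp only [log_cos_pi_div_four, sin_pi_div_four_eq, ← sq, h5, Real.sin_zero, Real.cos_zero,
      Real.log_one, h4]
    field_simp
    ring
  · refine HasDerivAt.congr_deriv ((((hasDerivAt_id x).const_mul 2).sub ((Real.hasDerivAt_sin x).mul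
      (Real.hasDerivAt_cos x))).sub ((hasDerivAt_log_cos hx).const_mul 2)) ?_
    have h := Real.cos_sq_add_sin_sq x
    rw [rhoOFactor]
    field_simp
    linear_combination -(Real.cos x + Real.sin x) * h

/-- The integrand is `(1 + 2 sin cos)(1 + tan) = 1 + 2 sin² + 2 sin cos + tan`. -/
theorem integral_rhoInfFactor : ∫ x, rhoInfFactor (maxCS x) (minCS x) ∂uniformAngle =
    2 * (1 + Real.log 2 / Real.pi) := by
  rw [integral_uniformAngle_eq_sub rhoInfFactor continuous_rhoInfFactor
    (fun x => 2 * x + Real.sin x ^ 2 - Real.sin x * Real.cos x - Real.log (Real.cos x))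
    fun x hx => ?_]
  · have hpi := Real.pi_ne_zero
    simp only [log_cos_pi_div_four, sin_pi_div_four_eq, ← sq, cos_sq_pi_div_four, Real.sin_zero,
      Real.cos_zero, Real.log_one]
    field_simp
    ring
  · refine HasDerivAt.congr_deriv (((((hasDerivAt_id x).const_mul 2).add ((Real.hasDerivAt_sin x).pow 2)).sub
      ((Real.hasDerivAt_sin x).mul (Real.hasDerivAt_cos x))).sub (hasDerivAt_log_cos hx)) ?_
    have h := Real.cos_sq_add_sin_sq x
    rw [rhoInfFactor]
    push_cast
    field_simp
    linear_combination -(2 * Real.cos x + Real.sin x) * h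

/-! ### Generic angles -/

/-- The angles at which no entry of a rotation block vanishes in its first row and the two entries
have different moduli. -/
def genericAngles (n : ℕ) : Set (Fin n → ℝ) :=
  {θ | ∀ i, Real.cos (θ i) ≠ 0 ∧ |Real.cos (θ i)| ≠ |Real.sin (θ i)|}

theorem isOpen_genericAngles (n : ℕ) : IsOpen (genericAngles n) := by
  simp only [genericAngles, Set.ofPred_forall]
  refine isOpen_iInter_of_finite fun i => ?_
  exact (isOpen_ne_fun (by fun_prop) (by fun_prop)).inter
    (isOpen_ne_fun (by fun_prop) (by fun_prop))

theorem countable_cos_eq_zero : {x : ℝ | Real.cos x = 0}.Countable := by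
  refine (Set.countable_range fun k : ℤ => (2 * (k : ℝ) + 1) * Real.pi / 2).mono ?_
  intro x hx
  obtain ⟨k, hk⟩ := Real.cos_eq_zero_iff.mp hx
  exact ⟨k, hk.symm⟩

/-- `|cos x| = |sin x|` forces `cos (2x) = 0`, so both exceptional sets are countable. -/
theorem ae_uniformAngle_generic :
    ∀ᵐ x ∂uniformAngle, Real.cos x ≠ 0 ∧ |Real.cos x| ≠ |Real.sin x| := by
  have hac : uniformAngle ≪ volume := ProbabilityTheory.cond_absolutelyContinuous
  apply hac.ae_le
  have h1 : ∀ᵐ x : ℝ, Real.cos x ≠ 0 := countable_cos_eq_zero.ae_notMem volume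
  have h2 : ∀ᵐ x : ℝ, Real.cos (2 * x) ≠ 0 :=
    (countable_cos_eq_zero.preimage (f := fun x : ℝ => 2 * x)
      (mul_right_injective₀ two_ne_zero)).ae_notMem volume
  filter_upwards [h1, h2] with x hx1 hx2
  refine ⟨hx1, fun h => hx2 ?_⟩
  rw [Real.cos_two_mul']
  rw [← sq_abs, h, sq_abs, sub_self]

theorem ae_mem_genericAngles (n : ℕ) :
    ∀ᵐ θ ∂(Measure.pi fun _ : Fin n => uniformAngle), θ ∈ genericAngles n := by
  refine ae_all_iff.mpr fun i => ?_
  exact (Measure.quasiMeasurePreserving_eval (fun _ : Fin n => uniformAngle) i).ae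
    ae_uniformAngle_generic

theorem continuous_butterfly (n : ℕ) : Continuous (butterfly n) := by
  induction n with
  | zero => exact continuous_const
  | succ n ih =>
    have hA : Continuous fun θ : Fin (n + 1) → ℝ => butterfly n fun i => θ i.castSucc :=
      ih.comp (by fun_prop)
    refine continuous_matrix ?_
    simp only [butterfly_succ, forall_block, kronTop_inl_inl, kronTop_inl_inr, kronTop_inr_inl,
      kronTop_inr_inr]
    have hE : ∀ i j, Continuous fun θ : Fin (n + 1) → ℝ =>
      butterfly n (fun i => θ i.castSucc) i j := fun i j => hA.matrix_elem i j
    refine ⟨fun i => ⟨fun j => ?_, fun j => ?_⟩, fun i => ⟨fun j => ?_, fun j => ?_⟩⟩ <;>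
      have := hE i j <;> fun_prop

/-- An open set of angles is σ-compact, and so is its continuous image. Measurability of the image
lets almost-sure statements about angles pass to the law of the matrix. -/
theorem measurableSet_image_genericAngles (n : ℕ) :
    MeasurableSet (butterfly n '' genericAngles n) := by
  have : BorelSpace (Matrix (Fin (2 ^ n)) (Fin (2 ^ n)) ℝ) :=
    inferInstanceAs (BorelSpace (Fin (2 ^ n) → Fin (2 ^ n) → ℝ))
  obtain ⟨F, hF, -, hU, -⟩ := (isOpen_genericAngles n).exists_iUnion_isClosed
  rw [← hU, Set.image_iUnion]
  refine MeasurableSet.iUnion fun k => ?_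
  obtain ⟨K, hK, hKU⟩ := (isSigmaCompact_univ.of_isClosed_subset (hF k) (Set.subset_univ _)).image
    (continuous_butterfly n)
  rw [← hKU]
  exact MeasurableSet.iUnion fun i => (hK i).isClosed.measurableSet

/-! ### Recovering the angles from the matrix -/

/-- The moduli of the tangents of the angles of a butterfly matrix. -/
noncomputable def absTan :
    (n : ℕ) → Matrix (Fin (2 ^ n)) (Fin (2 ^ n)) ℝ → Fin n → ℝ
  | 0, _ => Fin.elim0
  | n + 1, A => Fin.snoc
      (absTan n fun i j => A (blockEquiv n (Sum.inl i)) (blockEquiv n (Sum.inl j)))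
      |A (blockEquiv n (Sum.inl 0)) (blockEquiv n (Sum.inr 0)) /
        A (blockEquiv n (Sum.inl 0)) (blockEquiv n (Sum.inl 0))|

theorem measurable_absTan (n : ℕ) : Measurable (absTan n) := by
  have hent : ∀ {m : ℕ} (i j : Fin m), Measurable fun A : Matrix (Fin m) (Fin m) ℝ => A i j :=
    fun i j => (measurable_pi_apply j).comp (measurable_pi_apply i)
  induction n with
  | zero => exact measurable_const
  | succ n ih =>
    refine measurable_pi_lambda _ fun k => ?_
    refine Fin.lastCases ?_ (fun k => ?_) k
    · simp only [absTan, Fin.snoc_last]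
      exact ((hent _ _).div (hent _ _)).abs
    · simp only [absTan, Fin.snoc_castSucc]
      refine (measurable_pi_apply k).comp (ih.comp ?_)
      exact measurable_pi_lambda _ fun i => measurable_pi_lambda _ fun j => hent _ _

theorem butterfly_zero_zero_ne (n : ℕ) (θ : Fin n → ℝ) (hθ : ∀ i, Real.cos (θ i) ≠ 0) :
    butterfly n θ 0 0 ≠ 0 := by
  induction n with
  | zero => simp [butterfly]
  | succ n ih =>
    have h0 : (0 : Fin (2 ^ (n + 1))) = blockEquiv n (Sum.inl 0) := by
      ext; simp
    rw [h0, butterfly_succ, kronTop_inl_inl]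
    exact mul_ne_zero (hθ _) (ih _ fun i => hθ _)

/-- The scalar `r` is there for the induction: the upper left block of `r • B` is `r cos θₙ` times
the smaller butterfly matrix, and ratios of entries ignore such a scalar. -/
theorem absTan_smul_butterfly (n : ℕ) (θ : Fin n → ℝ) (hθ : ∀ i, Real.cos (θ i) ≠ 0) {r : ℝ}
    (hr : r ≠ 0) (i : Fin n) : absTan n (r • butterfly n θ) i = |Real.tan (θ i)| := by
  induction n generalizing r with
  | zero => exact i.elim0
  | succ n ih =>
    have h0 := butterfly_zero_zero_ne n (fun i => θ i.castSucc) fun i => hθ _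
    rw [butterfly_succ, smul_kronTop]
    refine Fin.lastCases ?_ (fun k => ?_) i
    · simp only [absTan, Fin.snoc_last, kronTop_inl_inl, kronTop_inl_inr]
      rw [mul_div_mul_right _ _ h0, mul_div_mul_left _ _ hr, Real.tan_eq_sin_div_cos]
    · simp only [absTan, Fin.snoc_castSucc, kronTop_inl_inl]
      exact ih (fun i => θ i.castSucc) (fun i => hθ _) (mul_ne_zero hr (hθ _)) k

/-- Together with its sine analogue, this shows that `maxCS` and `minCS` depend on the angle only
through `|tan|`, hence that they can be recovered from the matrix. -/
theorem abs_cos_arctan_abs_tan {x : ℝ} (hx : Real.cos x ≠ 0) :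
    |Real.cos (Real.arctan |Real.tan x|)| = |Real.cos x| := by
  rw [← sq_eq_sq_iff_abs_eq_abs, Real.cos_sq_arctan, sq_abs, ← Real.inv_one_add_tan_sq hx, one_div]

theorem abs_sin_arctan_abs_tan {x : ℝ} (hx : Real.cos x ≠ 0) :
    |Real.sin (Real.arctan |Real.tan x|)| = |Real.sin x| := by
  have h := abs_cos_arctan_abs_tan hx
  rw [← sq_eq_sq_iff_abs_eq_abs] at h ⊢
  rw [Real.sin_sq, Real.sin_sq, h]

/-- Expectation of a function of the Haar-butterfly matrix which on generic matrices is a product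
over the angles. No measurability of the function itself is needed. -/
theorem integral_haarButterfly {Ω : Type*} [MeasurableSpace Ω] {P : Measure Ω} {n : ℕ}
    {B : Ω → Matrix (Fin (2 ^ n)) (Fin (2 ^ n)) ℝ} (hB : HasLaw B (haarButterfly n) P)
    {f : Matrix (Fin (2 ^ n)) (Fin (2 ^ n)) ℝ → ℝ} {F : ℝ → ℝ → ℝ}
    (hF : Continuous fun x => F (maxCS x) (minCS x))
    (hf : ∀ θ ∈ genericAngles n, f (butterfly n θ) = ∏ i, F (maxCS (θ i)) (minCS (θ i))) :
    Integrable (fun ω => f (B ω)) P ∧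
      ∫ ω, f (B ω) ∂P = (∫ x, F (maxCS x) (minCS x) ∂uniformAngle) ^ n := by
  set φ : ℝ → ℝ := fun x => F (maxCS x) (minCS x) with hφ
  set μ := Measure.pi fun _ : Fin n => uniformAngle with hμ
  -- A measurable representative of `f`: the unknown angles are replaced by `arctan |tan θᵢ|`, which
  -- has the same `maxCS` and `minCS`.
  let g : Matrix (Fin (2 ^ n)) (Fin (2 ^ n)) ℝ → ℝ :=
    fun A => ∏ i, φ (Real.arctan (absTan n A i))
  have hg : Measurable g := by
    refine Finset.measurable_prod _ fun i _ => hF.measurable.comp ?_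
    exact Real.measurable_arctan.comp ((measurable_pi_apply i).comp (measurable_absTan n))
  have hgθ : ∀ θ ∈ genericAngles n, g (butterfly n θ) = ∏ i, φ (θ i) := by
    intro θ hθ
    refine Finset.prod_congr rfl fun i _ => ?_
    have h1 := absTan_smul_butterfly n θ (fun i => (hθ i).1) one_ne_zero i
    rw [one_smul] at h1
    simp only [hφ, maxCS, minCS, h1, abs_cos_arctan_abs_tan (hθ i).1,
      abs_sin_arctan_abs_tan (hθ i).1]
  have hmeas := (measurable_butterfly n).aemeasurable (μ := μ)
  have hmem : ∀ᵐ A ∂haarButterfly n, A ∈ butterfly n '' genericAngles n := by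
    refine (ae_map_iff hmeas (p := (· ∈ butterfly n '' genericAngles n))
      (measurableSet_image_genericAngles n)).mpr ?_
    exact (ae_mem_genericAngles n).mono fun θ hθ => Set.mem_image_of_mem _ hθ
  -- The equality has to hold almost everywhere in the space of matrices, not merely after
  -- composition with `butterfly`, since `f` is not known to be measurable.
  have hfg : f =ᵐ[haarButterfly n] g := by
    filter_upwards [hmem]
    rintro _ ⟨θ, hθ, rfl⟩
    rw [hf θ hθ, hgθ θ hθ]
  have hgae : (fun θ => g (butterfly n θ)) =ᵐ[μ] fun θ => ∏ i, φ (θ i) :=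
    (ae_mem_genericAngles n).mono hgθ
  have hint : Integrable g (haarButterfly n) := by
    rw [haarButterfly, integrable_map_measure hg.aestronglyMeasurable hmeas]
    refine Integrable.congr ?_ hgae.symm
    exact Integrable.fintype_prod fun _ => integrable_uniformAngle hF
  have hfint : Integrable f (haarButterfly n) := hint.congr hfg.symm
  constructor
  · rw [← hB.map_eq] at hfint
    exact hfint.comp_aemeasurable hB.aemeasurable
  · have h1 := hB.integral_comp hfint.aestronglyMeasurable
    rw [Function.comp_def] at h1
    rw [h1, integral_congr_ae hfg, haarButterfly, integral_map hmeas hg.aestronglyMeasurable,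
      integral_congr_ae hgae, integral_fintype_prod_eq_pow, Fintype.card_fin]

/-! ### Powers of the one-angle integrals as powers of `N` -/

theorem pow_eq_rpow_logb {a : ℝ} (ha : 0 < a) (n : ℕ) :
    a ^ n = ((2 : ℝ) ^ n) ^ Real.logb 2 a := by
  rw [← Real.rpow_natCast 2 n, ← Real.rpow_mul zero_le_two, mul_comm, Real.rpow_mul zero_le_two,
    Real.rpow_logb two_pos (by norm_num) ha, Real.rpow_natCast]

theorem two_mul_pow_eq_rpow {a : ℝ} (ha : 0 < a) (n : ℕ) :
    (2 * a) ^ n = ((2 : ℝ) ^ n) ^ (1 + Real.logb 2 a) := by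
  rw [pow_eq_rpow_logb (by positivity), Real.logb_mul two_ne_zero ha.ne',
    Real.logb_self_eq_one one_lt_two]

end ButterflyGE

open ButterflyGE in
theorem corollary2p5 {Ω : Type*} [MeasurableSpace Ω] (P : Measure Ω) (n : ℕ)
    (B : Ω → Matrix (Fin (2 ^ n)) (Fin (2 ^ n)) ℝ)
    (hB : HasLaw B (ButterflyGE.haarButterfly n) P) :
    (Integrable (fun ω => ButterflyGE.kappaInf (B ω)) P ∧
      ∫ ω, ButterflyGE.kappaInf (B ω) ∂P =
        ((2 : ℝ) ^ n) ^ Real.logb 2 (1 + 2 / Real.pi)) ∧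
    ∀ piv : ButterflyGE.PivotRule (2 ^ n),
      (ButterflyGE.IsPartialPivoting piv ∨ ButterflyGE.IsRookPivoting piv) →
      (Integrable (fun ω => ButterflyGE.kappaInf (B ω) * ButterflyGE.rho piv (B ω)) P ∧
        ∫ ω, ButterflyGE.kappaInf (B ω) * ButterflyGE.rho piv (B ω) ∂P =
          ((2 : ℝ) ^ n) ^ (1 + Real.logb 2 (2 / Real.pi * (1 + Real.log 2)))) ∧
      (Integrable (fun ω => ButterflyGE.kappaInf (B ω) * ButterflyGE.rhoO piv (B ω)) P ∧
        ∫ ω, ButterflyGE.kappaInf (B ω) * ButterflyGE.rhoO piv (B ω) ∂P =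
          ((2 : ℝ) ^ n) ^ (1 + Real.logb 2 (1 + (Real.log 4 - 1) / Real.pi))) ∧
      (Integrable (fun ω => ButterflyGE.kappaInf (B ω) * ButterflyGE.rhoInf piv (B ω)) P ∧
        ∫ ω, ButterflyGE.kappaInf (B ω) * ButterflyGE.rhoInf piv (B ω) ∂P =
          ((2 : ℝ) ^ n) ^ (1 + Real.logb 2 (1 + Real.log 2 / Real.pi))) := by
  have hpi := Real.pi_pos
  have hlog2 := Real.log_pos one_lt_two
  have hlog4 : 0 < Real.log 4 - 1 := by
    have h4 : Real.log 4 = 2 * Real.log 2 := by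
      rw [show (4 : ℝ) = 2 ^ 2 by norm_num, Real.log_pow]; norm_num
    linarith [Real.log_two_gt_d9]
  refine ⟨?_, fun piv hpiv => ⟨?_, ?_, ?_⟩⟩
  · rw [← pow_eq_rpow_logb (by positivity), ← integral_kappaFactor]
    exact integral_haarButterfly hB continuous_kappaFactor fun θ _ => kappaInf_butterfly n θ
  · rw [← two_mul_pow_eq_rpow (by positivity), ← integral_rhoFactor]
    exact integral_haarButterfly (f := fun A => kappaInf A * rho piv A) hB continuous_rhoFactor
      fun θ hθ => (growth_butterfly n θ (fun i => (hθ i).2) hpiv).1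
  · rw [← two_mul_pow_eq_rpow (by positivity), ← integral_rhoOFactor]
    exact integral_haarButterfly (f := fun A => kappaInf A * rhoO piv A) hB continuous_rhoOFactor
      fun θ hθ => (growth_butterfly n θ (fun i => (hθ i).2) hpiv).2.1
  · rw [← two_mul_pow_eq_rpow (by positivity), ← integral_rhoInfFactor]
    exact integral_haarButterfly (f := fun A => kappaInf A * rhoInf piv A) hB
      continuous_rhoInfFactor
      fun θ hθ => (growth_butterfly n θ (fun i => (hθ i).2) hpiv).2.2
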